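/- **Setting.** Let $0\le p,q\le 1$ with $p+q>0$. The *perturbed coin* $(C_t)_{t\in\mathbb Z}$ is the stationary Markov chain on $\{0,1\}$ that leaves $0$ with probability $p$ and leaves $1$ with probability $q$ (stationary law $\frac{q}{p+q},\frac{p}{p+q}$). The *heralding coin* $P_h^+$ is the law of the process $X$ obtained from $C$ by replacing the first $0$ of every maximal block of consecutive $0$s by $2$; $P_h^-$ is the law of the time-reversed process $Y_t=X_{-(t+1)}$. Let $s_j^-=\{\overleftarrow y : y_{-1}=j\}$ for $j=0,1,2$. A *quantum model* of a process law $P$ on $A^{\mathbb Z}$ ($A$ finite) consists of a complex Hilbert space $H$, a measurable encoding $f$ of pasts $\overleftarrow x=\dots x_{-2}x_{-1}$ into unit vectors (pure states) of $H$, and a quantum measurement process $\mathcal M$ on $H$ with outcomes in $A$, i.e. completely positive maps $\omega\mapsto\sum_k K_{a,k}\,\omega\, K_{a,k}^\dagger$, $a\in A$, with $\sum_{a,k}K_{a,k}^\dagger K_{a,k}=1$, such that for $P$-almost every past $\overleftarrow x$, on the state $f(\overleftarrow x)$, the process $\mathcal M$ (i) outputs $a$ with probability $P(X_0=a\mid\overleftarrow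 x)$ and (ii) then leaves the system in the state $f(\overleftarrow x a)$. Its entropy is $C_q=S(\rho)=-\operatorname{Tr}\rho\log\rho\in[0,\infty]$ with $\rho=\int |f(\overleftarrow x)\rangle\langle f(\overleftarrow x)|\,dP(\overleftarrow x)$. A model of $P$ is *optimal* if no model of $P$ (on any Hilbert space, with any encoding) has smaller entropy. Let $$|s_0^-\rangle=|0\rangle,\qquad |s_1^-\rangle=\sqrt q\,|0\rangle+\sqrt{1-q}\,|1\rangle,\qquad |s_2^-\rangle=|1\rangle$$ in $\mathbb C^2$, and let $\mathcal Q^-$ encode every past in $s_j^-$ into $|s_j^-\rangle$. Its measurement process acts on the memory qubit and two ancilla qubits in the state $|0\rangle$: apply $U_p$ to qubit 2 if qubit 1 is $|0\rangle$, then $U_q$ to qubit 3 if qubit 1 is $|1\rangle$, then the Pauli operator $X$ to qubit 3 if qubit 2 is $|1\rangle$, where $U_p,U_q$ are unitaries with $U_p|0\rangle=\sqrt{1-p}\,|0\rangle+\sqrt p\,|1\rangle$ and $U_q|0\rangle=\sqrt q\,|0\rangle+\sqrt{1-q}\,|1\rangle$; measure qubits 1 and 2, reading the results $00,10,01$ as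 the outputs $0,1,2$, and keep qubit 3 as the new memory. **Theorem.** 1. $P_h^-(\overleftarrow y\in s_j^-)=\pi_j^-$ with $\pi_0^-=\frac{q-pq}{p+q}$, $\pi_1^-=\frac{p}{p+q}$, $\pi_2^-=\frac{pq}{p+q}$, and the memory state of $\mathcal Q^-$ is $\rho^-=\sum_j\pi_j^-|s_j^-\rangle\langle s_j^-|$. 2. $\mathcal Q^-$ is a quantum model of $P_h^-$, and it is optimal. 3. Suppose $0<p<1$ and $q>0$. If a quantum model of $P_h^-$ encodes every past in $s_j^-$ into one and the same unit vector $|\psi_j\rangle$ ($j=0,1,2$), then $|\langle\psi_j|\psi_k\rangle|\le|\langle s_j^-|s_k^-\rangle|$ for all $j,k$, and there are $r\in[0,1]$, $\theta\in[0,\pi/2]$, $\alpha,\omega\in[0,2\pi]$ with $r\sin\theta\le\sqrt q$ and $\sqrt{1-r^2}\le\sqrt{1-q}$ such that some linear isometry from $\operatorname{span}\{\psi_0,\psi_1,\psi_2\}$ into $\mathbb C^3$ maps $$|\psi_0\rangle\mapsto|0\rangle,\quad |\psi_1\rangle\mapsto r\sin\theta\,e^{i\omega}|0\rangle+\sqrt{1-r^2}\,e^{i\alpha}|1\rangle+r\cos\theta\,|2\rangle,\quad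 |\psi_2\rangle\mapsto|1\rangle .$$ 4. If $|\psi_0\rangle,|\psi_1\rangle,|\psi_2\rangle$ are unit vectors of a complex Hilbert space with $|\langle\psi_j|\psi_k\rangle|\le|\langle s_j^-|s_k^-\rangle|$ for all $j,k$, then the spectrum of $\rho^-$ majorizes that of $\sigma=\sum_j\pi_j^-|\psi_j\rangle\langle\psi_j|$ (eigenvalues counted with multiplicity and padded with zeros): for every $n$ the sum of the $n$ largest eigenvalues of $\sigma$ is at most that of $\rho^-$, and the traces agree. -/

import Mathlib

open MeasureTheory ProbabilityTheory

noncomputable section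

namespace HeraldingCoin

/-! ### Operators and spectra on a complex Hilbert space -/

section Operators

variable {H : Type*} [NormedAddCommGroup H] [InnerProductSpace ℂ H]

/-- The operator `|v⟩⟨v|`. -/
def ketBra (v : H) : H →L[ℂ] H := InnerProductSpace.rankOne ℂ v v

/-- The ensemble state `∑ i, w i |ψ i⟩⟨ψ i|`. -/
def mixture (w : Fin 3 → ℝ) (ψ : Fin 3 → H) : H →L[ℂ] H :=
  ∑ i, ((w i : ℝ) : ℂ) • ketBra (ψ i)

/-- Index set for the (real) eigenvalues of `T`, each repeated according to its multiplicity.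
A density operator has real eigenvalues, and its eigenspaces for nonzero eigenvalues have finite
dimension; an infinite-dimensional kernel contributes no index, i.e. its zeros are left out. -/
def SpecIndex (T : H →L[ℂ] H) : Type :=
  Σ μ : ℝ, Fin (Module.finrank ℂ (Module.End.eigenspace (T : H →ₗ[ℂ] H) (μ : ℂ)))

/-- The family of eigenvalues of `T`, repeated according to multiplicity. -/
def spec (T : H →L[ℂ] H) : SpecIndex T → ℝ := fun i => i.1

/-- The von Neumann entropy `-Tr (ρ log ρ) = ∑ -λ log λ` of a density operator, the sum being over
the eigenvalues with multiplicity; it may be infinite. -/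
def vonNeumannEntropy (ρ : H →L[ℂ] H) : ENNReal :=
  ∑' i : SpecIndex ρ, ENNReal.ofReal (Real.negMulLog (spec ρ i))

end Operators

/-- The sum of the `n` largest members of a summable family of non-negative reals
(padded with zeros if there are fewer than `n`). -/
def largestSum {ι : Type*} (a : ι → ℝ) (n : ℕ) : ℝ :=
  ⨆ s : {s : Finset ι // s.card ≤ n}, ∑ i ∈ s.1, a i

/-- `a ≻ b` for summable families of non-negative reals: for every `n` the `n` largest members
of `a` sum to at least as much as the `n` largest members of `b`, and the totals agree. -/
def Majorizes {ι κ : Type*} (a : ι → ℝ) (b : κ → ℝ) : Prop :=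
  (∀ n, largestSum b n ≤ largestSum a n) ∧ ∃ t : ℝ, HasSum a t ∧ HasSum b t

/-! ### Stochastic processes and their quantum models -/

section Models

variable {A : Type*} [MeasurableSpace A]

/-- The past `… x₋₂ x₋₁` of a bi-infinite sequence; position `n` holds `x₋₁₋ₙ`. -/
def past (x : ℤ → A) : ℕ → A := fun n => x (-1 - (n : ℤ))

/-- The past `x a` obtained from the past `x` by appending the newly emitted symbol `a`. -/
def appendPast (x : ℕ → A) (a : A) : ℕ → A
  | 0 => a
  | n + 1 => x n

/-- The conditional probability `P(X₀ = a | past)`, a function of the realization `x`. -/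
def nextProb (P : Measure (ℤ → A)) (a : A) : (ℤ → A) → ℝ :=
  P⟦{x : ℤ → A | x 0 = a} | MeasurableSpace.comap past MeasurableSpace.pi⟧

variable {H : Type*} [NormedAddCommGroup H] [InnerProductSpace ℂ H] [CompleteSpace H]
  {κ : Type*}

/-- `IsQuantumModel P f K`: the encoding `f` of pasts into pure states of a system with Hilbert
space `H`, together with the quantum measurement process with outcomes in `A` given by the Kraus
operators `K a k` (outcome `a` acts as `ω ↦ ∑ k, K a k ω (K a k)†`), is a quantum model of the
process with law `P`. -/
structure IsQuantumModel (P : Measure (ℤ → A)) (f : (ℕ → A) → H)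
    (K : A → κ → H →L[ℂ] H) : Prop where
  /-- Every past is encoded into a pure state. -/
  norm_encode : ∀ x, ‖f x‖ = 1
  /-- The encoding is measurable for the law of the past. -/
  measurable_encode : AEStronglyMeasurable f (P.map past)
  /-- `∑ a k, (K a k)† (K a k) = 1`. -/
  kraus_complete : ∀ v : H, HasSum (fun i : A × κ => ‖K i.1 i.2 v‖ ^ 2) (‖v‖ ^ 2)
  /-- (i) In state `f(past)` the symbol `a` is emitted with probability `P(X₀ = a | past)`. -/
  output : ∀ a, ∀ᵐ x ∂P,
    HasSum (fun k => ‖K a k (f (past x))‖ ^ 2) (nextProb P a x)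
  /-- (ii) When `a` is emitted, the system passes from `f(past)` to `f(past a)`; the equation is
  the one between the unnormalized states. -/
  update : ∀ a, ∀ᵐ x ∂P,
    HasSum (fun k => ketBra (K a k (f (past x))))
      (((nextProb P a x : ℝ) : ℂ) • ketBra (f (appendPast (past x) a)))

/-- The average state `ρ = ∑ P(past) |f(past)⟩⟨f(past)|` of the memory. -/
def memoryState (P : Measure (ℤ → A)) (f : (ℕ → A) → H) : H →L[ℂ] H :=
  ∫ x, ketBra (f x) ∂(P.map past)

/-- The entropy `C_q` of a quantum model. -/
def modelEntropy (P : Measure (ℤ → A)) (f : (ℕ → A) → H) : ENNReal :=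
  vonNeumannEntropy (memoryState P f)

end Models

/-- `(f, K)` is an optimal quantum model of `P`: no quantum model of `P`, on whatever Hilbert
space, with whatever encoding of the pasts, has smaller entropy. -/
def IsOptimalQuantumModel.{u, v, a, w, z} {A : Type a} [MeasurableSpace A]
    {H : Type w} [NormedAddCommGroup H] [InnerProductSpace ℂ H] [CompleteSpace H] {κ : Type z}
    (P : Measure (ℤ → A)) (f : (ℕ → A) → H) (K : A → κ → H →L[ℂ] H) : Prop :=
  IsQuantumModel P f K ∧
    ∀ (H' : Type u) [NormedAddCommGroup H'] [InnerProductSpace ℂ H'] [CompleteSpace H']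
      (κ' : Type v) (f' : (ℕ → A) → H') (K' : A → κ' → H' →L[ℂ] H'),
      IsQuantumModel P f' K' → modelEntropy P f ≤ modelEntropy P f'

/-! ### The perturbed coin and the heralding coin -/

/-- One-step transition probabilities of the perturbed coin: heads (`0`) flips with
probability `p`, tails (`1`) flips with probability `q`. -/
def coinStep (p q : ℝ) : Fin 2 → Fin 2 → ℝ := ![![1 - p, p], ![q, 1 - q]]

/-- Stationary distribution of the perturbed coin. -/
def coinStat (p q : ℝ) : Fin 2 → ℝ := ![q / (p + q), p / (p + q)]

/-- `μ` is the law on bi-infinite sequences of the stationary perturbed coin, i.e. of the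
stationary Markov chain with the above transition probabilities: its values on cylinders. -/
def IsPerturbedCoin (p q : ℝ) (μ : Measure (ℤ → Fin 2)) : Prop :=
  ∀ (t : ℤ) (n : ℕ) (w : ℕ → Fin 2),
    μ {c | ∀ i ≤ n, c (t + (i : ℤ)) = w i} =
      ENNReal.ofReal (coinStat p q (w 0) * ∏ i ∈ Finset.range n, coinStep p q (w i) (w (i + 1)))

/-- Replace the first `0` of each maximal block of consecutive `0`s by `2`. -/
def herald (c : ℤ → Fin 2) : ℤ → Fin 3 := fun t =>
  if c t = 1 then 1 else if c (t - 1) = 1 then 2 else 0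

/-- Time reversal `Y_t = X_{-(t+1)}`. -/
def timeReverse {A : Type*} (x : ℤ → A) : ℤ → A := fun t => x (-(t + 1))

/-- The law `P_h^+` of the heralding coin built from the coin law `μ`. -/
def heraldingLaw (μ : Measure (ℤ → Fin 2)) : Measure (ℤ → Fin 3) := μ.map herald

/-- The law `P_h^-` of the time-reversed heralding coin. -/
def reversedHeraldingLaw (μ : Measure (ℤ → Fin 2)) : Measure (ℤ → Fin 3) :=
  (heraldingLaw μ).map timeReverse

/-- The probabilities `π₀⁻, π₁⁻, π₂⁻`. -/
def retroWeight (p q : ℝ) : Fin 3 → ℝ :=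
  ![(q - p * q) / (p + q), p / (p + q), p * q / (p + q)]

/-! ### The retrocausal model `Q⁻` -/

/-- The qubit states `|s₀⁻⟩ = |0⟩`, `|s₁⁻⟩ = √q |0⟩ + √(1-q) |1⟩`, `|s₂⁻⟩ = |1⟩`. -/
def retroState (q : ℝ) : Fin 3 → EuclideanSpace ℂ (Fin 2) :=
  ![!₂[1, 0], !₂[(√q : ℂ), (√(1 - q) : ℂ)], !₂[0, 1]]

/-- The encoding of `Q⁻`: a past whose last symbol is `j` is encoded into `|s_j⁻⟩`. -/
def retroEncode (q : ℝ) (y : ℕ → Fin 3) : EuclideanSpace ℂ (Fin 2) := retroState q (y 0)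

/-- On three qubits: apply `U` to qubit `t` if qubit `c` is in the state `|w⟩`. -/
def controlled (c t : Fin 3) (w : Fin 2) (U : Matrix (Fin 2) (Fin 2) ℂ) :
    Matrix (Fin 3 → Fin 2) (Fin 3 → Fin 2) ℂ :=
  Matrix.of fun x y =>
    if ∀ j, j ≠ t → x j = y j then
      if y c = w then U (x t) (y t) else if x t = y t then 1 else 0
    else 0

/-- A unitary with `U_p |0⟩ = √(1-p) |0⟩ + √p |1⟩`. -/
def gateP (p : ℝ) : Matrix (Fin 2) (Fin 2) ℂ :=
  !![(√(1 - p) : ℂ), -(√p : ℂ); (√p : ℂ), (√(1 - p) : ℂ)]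

/-- A unitary with `U_q |0⟩ = √q |0⟩ + √(1-q) |1⟩`. -/
def gateQ (q : ℝ) : Matrix (Fin 2) (Fin 2) ℂ :=
  !![(√q : ℂ), -(√(1 - q) : ℂ); (√(1 - q) : ℂ), (√q : ℂ)]

/-- The circuit of `Q⁻`: on the memory qubit and two ancillas in the state `|0⟩`, first `U_p` on
the second qubit if the first one is `|0⟩`, then `U_q` on the third one if the first one is `|1⟩`,
then the Pauli operator `X` on the third one if the second one is `|1⟩`. -/
def retroCircuit (p q : ℝ) : Matrix (Fin 3 → Fin 2) (Fin 3 → Fin 2) ℂ :=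
  controlled 1 2 1 !![0, 1; 1, 0] * controlled 0 2 1 (gateQ q) * controlled 0 1 0 (gateP p)

/-- The outcomes of measuring the first two qubits: `00`, `10`, `01` stand for the symbols
`0`, `1`, `2`. -/
def outcomeCode : Fin 3 → Fin 2 × Fin 2 := ![(0, 0), (1, 0), (0, 1)]

/-- The Kraus operators of the measurement process `M⁻`: run the circuit, measure the first two
qubits, keep the third one as the new memory. -/
def retroKraus (p q : ℝ) (y : Fin 3) (_ : Unit) :
    EuclideanSpace ℂ (Fin 2) →L[ℂ] EuclideanSpace ℂ (Fin 2) :=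
  Matrix.toEuclideanCLM (n := Fin 2) (𝕜 := ℂ) (Matrix.of fun c w =>
    retroCircuit p q ![(outcomeCode y).1, (outcomeCode y).2, c] ![w, 0, 0])

/-- The three-parameter normal form of the internal states:
`|0⟩`, `r sin θ e^{iω} |0⟩ + √(1-r²) e^{iα} |1⟩ + r cos θ |2⟩`, `|1⟩`. -/
def genericState (r θ α ω : ℝ) : Fin 3 → EuclideanSpace ℂ (Fin 3) :=
  ![!₂[1, 0, 0],
    !₂[((r * Real.sin θ : ℝ) : ℂ) * Complex.exp (ω * Complex.I),
      ((√(1 - r ^ 2) : ℝ) : ℂ) * Complex.exp (α * Complex.I),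
      ((r * Real.cos θ : ℝ) : ℂ)],
    !₂[0, 1, 0]]

end HeraldingCoin

end

open HeraldingCoin

universe u v

/-! Three facts carry the theorem.

Dynamics. A two-state chain satisfies detailed balance, so the coin can be run backwards
(`coin_backward`). Hence the reversed heralding coin is Markov with matrix `reverseStep`
(`nextProb_reversedHeraldingLaw`), and the circuit of `Q⁻` realizes this matrix exactly
(`retroKraus_retroState`).

Overlaps. A complete Kraus family preserves inner products. Cauchy–Schwarz within each outcome then
bounds the overlap of any two memory states by the Bhattacharyya overlap of their output laws
(`norm_inner_le_sum_sqrt`). For rows of `reverseStep` this bound equals the overlap of the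
corresponding states of `Q⁻` (`sum_sqrt_reverseStep`). So the overlaps of every model, even one that
splits the classes `s_j⁻`, are dominated almost surely by those of `Q⁻`, which are moreover
nonnegative reals.

Spectra. Let `v` be a unit eigenvector, with eigenvalue `μ`, of an ensemble with dominated overlaps.
Expanding `‖ρ v‖² = μ²` over pairs of ensemble states and applying Cauchy–Schwarz on each class
bounds `μ²` by the weighted Gram form of `Q⁻` at a vector with squared norm `μ`. That form is at
most `l` times the squared norm, where `l` is the top eigenvalue of `ρ⁻`; hence `μ ≤ l`
(`eigenvalue_integral_ketBra_le`). As `Q⁻` lives on a qubit, `ρ⁻` has at most two eigenvalues. The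
bound on the largest eigenvalue, together with equal traces, therefore already gives majorization
and minimal entropy (`majorizes_and_entropy_le`). The competing memory may be infinite-dimensional,
so that its eigenvalues sum to one needs proof (`spec_integral_ketBra`).

The generic form is Gram–Schmidt: the overlap bound forces `ψ 0 ⊥ ψ 2`, and polar coordinates
describe `ψ 1`. -/

noncomputable section

namespace HeraldingCoin

/-! ### Eigenvectors of compact symmetric operators -/

section Spectral

variable {H : Type u} [NormedAddCommGroup H] [InnerProductSpace ℂ H]

@[simp] lemma ketBra_apply (v x : H) : ketBra v x = inner ℂ v x • v := rfl

lemma norm_ketBra (v : H) : ‖ketBra v‖ = ‖v‖ ^ 2 := by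
  rw [ketBra, InnerProductSpace.norm_rankOne, sq]

lemma continuous_ketBra : Continuous (ketBra : H → H →L[ℂ] H) := by
  have h : (ketBra : H → H →L[ℂ] H) = fun v => (innerSL ℂ v).smulRight v := rfl
  rw [h]
  fun_prop

lemma isCompactOperator_ketBra (v : H) : IsCompactOperator (ketBra v) := by
  have h : ketBra v = (ContinuousLinearMap.toSpanSingleton ℂ v) ∘L (innerSL ℂ v) := rfl
  rw [h]
  have h' : IsCompactOperator (ContinuousLinearMap.toSpanSingleton ℂ v) :=
    isCompactOperator_of_locallyCompactSpace_rng _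
  exact h'.comp_clm (innerSL ℂ v)

/-- An orthonormal family of eigenvectors realizing `spec T`. -/
lemma exists_orthonormal_eigenvectors {T : H →L[ℂ] H} (hT : T.IsSymmetric) :
    ∃ b : SpecIndex T → H, Orthonormal ℂ b ∧ (∀ i, T (b i) = ((spec T i : ℝ) : ℂ) • b i) ∧
      ∀ μ : ℝ, FiniteDimensional ℂ (Module.End.eigenspace (T : H →ₗ[ℂ] H) (μ : ℂ)) →
        Module.End.eigenspace (T : H →ₗ[ℂ] H) (μ : ℂ) ≤
          Submodule.span ℂ (b '' {i | spec T i = μ}) := by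
  classical
  have key : ∀ μ : ℝ, ∃ e : Fin (Module.finrank ℂ
      (Module.End.eigenspace (T : H →ₗ[ℂ] H) (μ : ℂ))) →
      Module.End.eigenspace (T : H →ₗ[ℂ] H) (μ : ℂ), Orthonormal ℂ e ∧
      (FiniteDimensional ℂ (Module.End.eigenspace (T : H →ₗ[ℂ] H) (μ : ℂ)) →
        ⊤ ≤ Submodule.span ℂ (Set.range e)) := by
    intro μ
    by_cases hfd : FiniteDimensional ℂ (Module.End.eigenspace (T : H →ₗ[ℂ] H) (μ : ℂ))
    · refine ⟨stdOrthonormalBasis ℂ _, (stdOrthonormalBasis ℂ _).orthonormal, fun _ => ?_⟩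
      rw [← OrthonormalBasis.coe_toBasis, Module.Basis.span_eq]
    -- In infinite dimension `finrank` takes its default value `0`, so such an eigenspace
    -- contributes no index.
    · have h0 : Module.finrank ℂ (Module.End.eigenspace (T : H →ₗ[ℂ] H) (μ : ℂ)) = 0 :=
        Module.finrank_of_not_finite hfd
      have : IsEmpty (Fin (Module.finrank ℂ
          (Module.End.eigenspace (T : H →ₗ[ℂ] H) (μ : ℂ)))) := by
        rw [h0]; infer_instance
      exact ⟨fun i => isEmptyElim i, Orthonormal.of_isEmpty _, fun h => absurd h hfd⟩
  choose e he hspan using key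
  refine ⟨fun i => (e i.1 i.2 : H), ?_, ?_, ?_⟩
  · have hV := (hT.orthogonalFamily_eigenspaces).comp
      (f := fun μ : ℝ => (μ : ℂ)) Complex.ofReal_injective
    exact hV.orthonormal_sigma_orthonormal he
  · rintro ⟨μ, i⟩
    exact Module.End.mem_eigenspace_iff.1 (e μ i).2
  · intro μ hfd x hx
    have h1 : (⟨x, hx⟩ : Module.End.eigenspace (T : H →ₗ[ℂ] H) (μ : ℂ)) ∈
        Submodule.span ℂ (Set.range (e μ)) := hspan μ hfd trivial
    have h2 := Submodule.mem_map_of_mem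
      (f := (Module.End.eigenspace (T : H →ₗ[ℂ] H) (μ : ℂ)).subtype) h1
    rw [Submodule.map_span] at h2
    refine Submodule.span_mono ?_ h2
    rintro _ ⟨_, ⟨i, rfl⟩, rfl⟩
    exact ⟨⟨μ, i⟩, rfl, rfl⟩

/-- Vectors orthogonal to all eigenvectors with nonzero eigenvalue lie in the kernel. -/
lemma apply_eq_zero_of_orthogonal [CompleteSpace H] {T : H →L[ℂ] H} (hc : IsCompactOperator T)
    (hT : T.IsSymmetric) {b : SpecIndex T → H}
    (hspan : ∀ μ : ℝ, FiniteDimensional ℂ (Module.End.eigenspace (T : H →ₗ[ℂ] H) (μ : ℂ)) →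
        Module.End.eigenspace (T : H →ₗ[ℂ] H) (μ : ℂ) ≤
          Submodule.span ℂ (b '' {i | spec T i = μ})) {v : H}
    (hv : ∀ i, spec T i ≠ 0 → inner ℂ (b i) v = 0) : T v = 0 := by
  -- By the spectral theorem it suffices that `T v` be orthogonal to every eigenspace. For the
  -- eigenvalue `0` this is symmetry; any other eigenspace is finite-dimensional and spanned by
  -- members of `b`.
  have h := ContinuousLinearMap.orthogonalComplement_iSup_eigenspaces_eq_bot hc hT
  rw [← Submodule.mem_bot ℂ, ← h, ← Submodule.iInf_orthogonal, Submodule.mem_iInf]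
  intro μ
  rw [Submodule.mem_orthogonal]
  intro w hw
  have hw' : T w = μ • w := Module.End.mem_eigenspace_iff.1 hw
  have hs : inner ℂ w (T v) = inner ℂ (T w) v := (hT w v).symm
  rw [hs, hw', inner_smul_left]
  by_cases hμ : μ = 0
  · simp [hμ]
  by_cases hw0 : w = 0
  · simp [hw0]
  have hreal : (starRingEnd ℂ) μ = μ :=
    hT.conj_eigenvalue_eq_self (Module.End.hasEigenvalue_of_hasEigenvector ⟨hw, hw0⟩)
  obtain ⟨r, rfl⟩ := Complex.conj_eq_iff_real.1 hreal
  have hr : r ≠ 0 := by rintro rfl; simp at hμ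
  have hwm := hspan r (ContinuousLinearMap.finite_dimensional_eigenspace hc _ hμ) hw
  have : Submodule.span ℂ (b '' {i | spec T i = r}) ≤ (ℂ ∙ v)ᗮ := by
    rw [Submodule.span_le]
    rintro _ ⟨i, hi, rfl⟩
    have hi' : spec T i = r := hi
    exact Submodule.mem_orthogonal_singleton_iff_inner_left.2 (hv i (hi' ▸ hr))
  rw [Submodule.mem_orthogonal_singleton_iff_inner_left.1 (this hwm), mul_zero]

/-- Parseval's identity on the closed span of an orthonormal family. -/
lemma hasSum_norm_sq_inner_of_mem_orthogonal_orthogonal [CompleteSpace H] {ι : Type*} {b : ι → H}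
    (hb : Orthonormal ℂ b) {x : H} (hx : x ∈ (Submodule.span ℂ (Set.range b))ᗮᗮ) :
    HasSum (fun i => ‖inner ℂ (b i) x‖ ^ 2) (‖x‖ ^ 2) := by
  set W := (Submodule.span ℂ (Set.range b))ᗮᗮ with hW
  have hbW : ∀ i, b i ∈ W := fun i =>
    Submodule.le_orthogonal_orthogonal _ (Submodule.subset_span ⟨i, rfl⟩)
  let b' : ι → W := fun i => ⟨b i, hbW i⟩
  have hb' : Orthonormal ℂ b' := hb.codRestrict W hbW
  have hbot : (Submodule.span ℂ (Set.range b'))ᗮ = ⊥ := by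
    rw [eq_bot_iff]
    intro y hy
    have h1 : (y : H) ∈ (Submodule.span ℂ (Set.range b))ᗮ := by
      rw [Submodule.mem_orthogonal]
      intro u hu
      induction hu using Submodule.span_induction with
      | mem u hu =>
        obtain ⟨i, rfl⟩ := hu
        exact (Submodule.mem_orthogonal _ _).1 hy (b' i) (Submodule.subset_span ⟨i, rfl⟩)
      | zero => simp
      | add u w _ _ hu hw => rw [inner_add_left, hu, hw, add_zero]
      | smul c u _ hu => rw [inner_smul_left, hu, mul_zero]
    have h2 := (Submodule.mem_orthogonal _ _).1 y.2 y h1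
    rw [inner_self_eq_zero] at h2
    exact (Submodule.mem_bot ℂ).2 (Subtype.ext h2)
  have h := (HilbertBasis.mkOfOrthogonalEqBot hb' hbot).hasSum_inner_mul_inner ⟨x, hx⟩ ⟨x, hx⟩
  rw [HilbertBasis.coe_mkOfOrthogonalEqBot] at h
  have h3 := Complex.hasSum_re h
  convert h3 using 1
  · ext i
    change ‖inner ℂ (b i) x‖ ^ 2 = (inner ℂ x (b i) * inner ℂ (b i) x).re
    rw [← inner_conj_symm x (b i), Complex.conj_mul']
    norm_cast
  · change _ = (inner ℂ x x).re
    rw [inner_self_eq_norm_sq_to_K]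
    norm_cast

end Spectral

/-! ### Ensemble states: compactness, symmetry and trace -/

section Ensemble

variable {H : Type u} [NormedAddCommGroup H] [InnerProductSpace ℂ H]
  {Ω : Type*} [MeasurableSpace Ω] {P : Measure Ω} [IsProbabilityMeasure P] {F : Ω → H}

lemma integrable_ketBra (hF : AEStronglyMeasurable F P) (h1 : ∀ x, ‖F x‖ = 1) :
    Integrable (fun x => ketBra (F x)) P := by
  refine Integrable.of_bound (continuous_ketBra.comp_aestronglyMeasurable hF) 1 ?_
  exact Filter.Eventually.of_forall fun x => by simp [norm_ketBra, h1]

lemma integrable_inner_smul (hF : AEStronglyMeasurable F P) (h1 : ∀ x, ‖F x‖ = 1) (v : H) :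
    Integrable (fun x => inner ℂ (F x) v • F x) P := by
  refine Integrable.of_bound ((hF.inner aestronglyMeasurable_const).smul hF) ‖v‖ ?_
  refine Filter.Eventually.of_forall fun x => ?_
  rw [norm_smul, h1, mul_one]
  exact (norm_inner_le_norm _ _).trans (by rw [h1, one_mul])

lemma integrable_norm_sq_inner (hF : AEStronglyMeasurable F P) (h1 : ∀ x, ‖F x‖ = 1) (v : H) :
    Integrable (fun x => ‖inner ℂ (F x) v‖ ^ 2) P := by
  refine Integrable.of_bound ((hF.inner aestronglyMeasurable_const).norm.pow 2) (‖v‖ ^ 2) ?_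
  refine Filter.Eventually.of_forall fun x => ?_
  rw [Real.norm_of_nonneg (by positivity)]
  gcongr
  exact (norm_inner_le_norm _ _).trans (by rw [h1, one_mul])

lemma integrable_norm_inner (hF : AEStronglyMeasurable F P) (h1 : ∀ x, ‖F x‖ = 1) (v : H) :
    Integrable (fun x => ‖inner ℂ (F x) v‖) P := by
  refine Integrable.of_bound (hF.inner aestronglyMeasurable_const).norm ‖v‖ ?_
  refine Filter.Eventually.of_forall fun x => ?_
  rw [norm_norm]
  exact (norm_inner_le_norm _ _).trans (by rw [h1, one_mul])

lemma integral_ketBra_apply (hF : AEStronglyMeasurable F P) (h1 : ∀ x, ‖F x‖ = 1) (v : H) :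
    (∫ x, ketBra (F x) ∂P) v = ∫ x, inner ℂ (F x) v • F x ∂P := by
  rw [ContinuousLinearMap.integral_apply (integrable_ketBra hF h1)]
  rfl

variable [CompleteSpace H]

lemma inner_integral_ketBra (hF : AEStronglyMeasurable F P) (h1 : ∀ x, ‖F x‖ = 1) (v : H) :
    inner ℂ v ((∫ x, ketBra (F x) ∂P) v) = ((∫ x, ‖inner ℂ (F x) v‖ ^ 2 ∂P : ℝ) : ℂ) := by
  rw [integral_ketBra_apply hF h1, ← integral_inner (integrable_inner_smul hF h1 v),
    ← integral_complex_ofReal]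
  congr 1 with x
  rw [inner_smul_right, ← inner_conj_symm v (F x), Complex.mul_conj', Complex.ofReal_pow]

/-- Rank-one operators are compact, and an average stays in the closed convex set of compact
operators. -/
lemma isCompactOperator_integral_ketBra (hF : AEStronglyMeasurable F P) (h1 : ∀ x, ‖F x‖ = 1) :
    IsCompactOperator (∫ x, ketBra (F x) ∂P : H →L[ℂ] H) := by
  have hconv : Convex ℝ {T : H →L[ℂ] H | IsCompactOperator T} :=
    ((compactOperator (RingHom.id ℂ) H H).restrictScalars ℝ).convex
  exact hconv.integral_mem isClosed_setOfPred_isCompactOperator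
    (Filter.Eventually.of_forall fun x => isCompactOperator_ketBra (F x)) (integrable_ketBra hF h1)

lemma isSymmetric_integral_ketBra (hF : AEStronglyMeasurable F P) (h1 : ∀ x, ‖F x‖ = 1) :
    (∫ x, ketBra (F x) ∂P).IsSymmetric := by
  intro v w
  change inner ℂ ((∫ x, ketBra (F x) ∂P) v) w = inner ℂ v ((∫ x, ketBra (F x) ∂P) w)
  rw [integral_ketBra_apply hF h1, integral_ketBra_apply hF h1,
    ← integral_inner (integrable_inner_smul hF h1 w), ← inner_conj_symm,
    ← integral_inner (integrable_inner_smul hF h1 v), ← integral_conj]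
  congr 1 with x
  simp only [inner_smul_right, map_mul, inner_conj_symm]
  ring

lemma spec_eq_integral (hF : AEStronglyMeasurable F P) (h1 : ∀ x, ‖F x‖ = 1) {v : H} {μ : ℝ}
    (hv : ‖v‖ = 1) (hμ : (∫ x, ketBra (F x) ∂P) v = (μ : ℂ) • v) :
    μ = ∫ x, ‖inner ℂ (F x) v‖ ^ 2 ∂P := by
  have h := inner_integral_ketBra hF h1 v
  rw [hμ, inner_smul_right, inner_self_eq_norm_sq_to_K, hv] at h
  have h2 : ((μ : ℝ) : ℂ) = ((∫ x, ‖inner ℂ (F x) v‖ ^ 2 ∂P : ℝ) : ℂ) := by simpa using h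
  exact_mod_cast h2

lemma inner_ae_eq_zero (hF : AEStronglyMeasurable F P) (h1 : ∀ x, ‖F x‖ = 1) {v : H}
    (hv : (∫ x, ketBra (F x) ∂P) v = 0) : ∀ᵐ x ∂P, inner ℂ (F x) v = 0 := by
  have h := inner_integral_ketBra hF h1 v
  rw [hv, inner_zero_right] at h
  have h2 : ∫ x, ‖inner ℂ (F x) v‖ ^ 2 ∂P = 0 := by exact_mod_cast h.symm
  rw [integral_eq_zero_iff_of_nonneg (fun x => by positivity)
    (integrable_norm_sq_inner hF h1 v)] at h2
  filter_upwards [h2] with x hx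
  simpa using hx

/-- The eigenvalues of an ensemble state are nonnegative and sum to one. -/
theorem spec_integral_ketBra (hF : AEStronglyMeasurable F P) (h1 : ∀ x, ‖F x‖ = 1) :
    (∀ i, 0 ≤ spec (∫ x, ketBra (F x) ∂P) i) ∧ HasSum (spec (∫ x, ketBra (F x) ∂P)) 1 := by
  set T := ∫ x, ketBra (F x) ∂P with hTdef
  have hT : T.IsSymmetric := isSymmetric_integral_ketBra hF h1
  have hc : IsCompactOperator T := isCompactOperator_integral_ketBra hF h1
  obtain ⟨b, hb, hbe, hspan⟩ := exists_orthonormal_eigenvectors hT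
  have hspec : ∀ i, spec T i = ∫ x, ‖inner ℂ (F x) (b i)‖ ^ 2 ∂P := fun i =>
    spec_eq_integral hF h1 (hb.1 i) (hbe i)
  have hnn : ∀ i, 0 ≤ spec T i := fun i => by
    rw [hspec]; exact integral_nonneg fun x => by positivity
  refine ⟨hnn, ?_⟩
  -- Bessel's inequality under the integral. The summability it yields leaves only countably many
  -- nonzero eigenvalues, as the exchange of sum and integral below requires.
  have hle : ∀ s : Finset (SpecIndex T), ∑ i ∈ s, spec T i ≤ 1 := by
    intro s
    simp_rw [hspec]
    rw [← integral_finsetSum _ fun i _ => integrable_norm_sq_inner hF h1 (b i)]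
    calc _ ≤ ∫ _, (1 : ℝ) ∂P := by
          refine integral_mono (integrable_finsetSum _ fun i _ =>
            integrable_norm_sq_inner hF h1 (b i)) (integrable_const _) fun x => ?_
          have := hb.sum_inner_products_le (s := s) (F x)
          rw [h1, one_pow] at this
          simpa only [norm_inner_symm] using this
      _ = 1 := by simp
  have hsum : Summable (spec T) := summable_of_sum_le hnn hle
  let S := {i // spec T i ≠ 0}
  have hScount : Countable S := hsum.countable_support.to_subtype
  let bS : S → H := fun i => b i.1
  have hbS : Orthonormal ℂ bS := hb.comp _ Subtype.val_injective
  let W := (Submodule.span ℂ (Set.range bS))ᗮ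
  have hker : ∀ v ∈ W, T v = 0 := by
    intro v hv
    refine apply_eq_zero_of_orthogonal hc hT hspan fun i hi => ?_
    exact (Submodule.mem_orthogonal _ _).1 hv _ (Submodule.subset_span ⟨⟨i, hi⟩, rfl⟩)
  -- Each vector of the kernel is orthogonal to `F x` outside a null set that depends on the vector.
  -- The essentially separable range of `F` lets these statements combine into one: the projection
  -- of `F x` to `W` vanishes almost surely.
  obtain ⟨t, ht, hFt⟩ := hF.isSeparable_ae_range
  have hQ : ∀ᵐ x ∂P, F x ∈ Wᗮ := by
    have hz : (fun x => W.starProjection (F x)) =ᵐ[P] 0 := by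
      refine ae_eq_zero_of_forall_dual_of_isSeparable ℂ
        (t := W.starProjection '' t) (ht.image W.starProjection.continuous) (fun c => ?_) ?_
      · obtain ⟨y, rfl⟩ := (InnerProductSpace.toDual ℂ H).surjective c
        have hy := inner_ae_eq_zero hF h1 (hker (W.starProjection y) (by simp))
        filter_upwards [hy] with x hx
        change inner ℂ y (W.starProjection (F x)) = 0
        rw [← Submodule.inner_starProjection_left_eq_right, ← inner_conj_symm, hx, map_zero]
      · filter_upwards [hFt] with x hx using ⟨_, hx, rfl⟩
    filter_upwards [hz] with x hx
    exact (Submodule.starProjection_apply_eq_zero_iff W).1 hx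
  have hpars : ∀ᵐ x ∂P, HasSum (fun i : S => ‖inner ℂ (F x) (bS i)‖ ^ 2) 1 := by
    filter_upwards [hQ] with x hx
    have := hasSum_norm_sq_inner_of_mem_orthogonal_orthogonal hbS hx
    rw [h1, one_pow] at this
    simpa only [norm_inner_symm] using this
  have hS : HasSum (fun i : S => spec T i.1) 1 := by
    have h := hasSum_integral_of_summable_integral_norm (μ := P)
      (F := fun (i : S) x => ‖inner ℂ (F x) (bS i)‖ ^ 2)
      (fun i => integrable_norm_sq_inner hF h1 _) ?_
    · have h2 : ∫ x, ∑' i : S, ‖inner ℂ (F x) (bS i)‖ ^ 2 ∂P = 1 := by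
        rw [integral_congr_ae (g := fun _ => (1 : ℝ))]
        · simp
        · filter_upwards [hpars] with x hx using hx.tsum_eq
      rw [h2] at h
      simpa only [hspec] using h
    · have : Summable fun i : S => spec T i.1 := hsum.subtype _
      refine this.congr fun i => ?_
      rw [hspec]
      refine integral_congr_ae (Filter.Eventually.of_forall fun x => ?_)
      simp [bS]
  exact (hasSum_subtype_iff_of_support_subset (s := {i | spec T i ≠ 0}) (fun i hi => hi)).1 hS

end Ensemble

/-! ### Bounding eigenvalues by classwise overlaps -/

section ClassBound

variable {Ω : Type*} {cls : Ω → Fin 3}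

lemma mul_comp_eq_sum_indicator (c : Ω → ℝ) (g : Fin 3 → ℝ) :
    (fun x => c x * g (cls x)) = fun x => ∑ j, (cls ⁻¹' {j}).indicator c x * g j := by
  classical
  ext x
  rw [Finset.sum_eq_single (cls x)]
  · simp
  · intro j _ hj
    rw [Set.indicator_of_notMem (by simpa using hj.symm), zero_mul]
  · simp

variable [MeasurableSpace Ω] {P : Measure Ω}

lemma integrable_mul_comp (hcls : Measurable cls) {c : Ω → ℝ} (hc : Integrable c P)
    (g : Fin 3 → ℝ) : Integrable (fun x => c x * g (cls x)) P := by
  rw [mul_comp_eq_sum_indicator]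
  exact integrable_finsetSum _ fun j _ =>
    (hc.indicator (hcls (measurableSet_singleton j))).mul_const _

lemma integral_mul_comp (hcls : Measurable cls) {c : Ω → ℝ} (hc : Integrable c P)
    (g : Fin 3 → ℝ) :
    ∫ x, c x * g (cls x) ∂P = ∑ j, (∫ x in cls ⁻¹' {j}, c x ∂P) * g j := by
  rw [mul_comp_eq_sum_indicator, integral_finsetSum _ fun j _ =>
    (hc.indicator (hcls (measurableSet_singleton j))).mul_const _]
  refine Finset.sum_congr rfl fun j _ => ?_
  rw [integral_mul_const, integral_indicator (hcls (measurableSet_singleton j))]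

variable [IsProbabilityMeasure P]

/-- The Cauchy–Schwarz inequality against the indicator of an event. -/
lemma setIntegral_le_sqrt_mul_sqrt {c : Ω → ℝ} (hc : Integrable c P)
    (hc2 : Integrable (fun x => c x ^ 2) P) (A : Set Ω) :
    ∫ x in A, c x ∂P ≤ √(P.real A) * √(∫ x in A, c x ^ 2 ∂P) := by
  rw [← Real.sqrt_mul measureReal_nonneg]
  refine Real.le_sqrt_of_sq_le ?_
  -- Expanding `∫_A (c - t)² ≥ 0` gives a quadratic in `t`; its nonpositive discriminant is the
  -- claim.
  have h : ∀ t : ℝ, 0 ≤ P.real A * (t * t) + (-2 * ∫ x in A, c x ∂P) * t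
      + ∫ x in A, c x ^ 2 ∂P := by
    intro t
    have h0 : 0 ≤ ∫ x in A, (c x - t) ^ 2 ∂P := integral_nonneg fun x => sq_nonneg _
    have h1 : ∫ x in A, (c x - t) ^ 2 ∂P =
        ∫ x in A, ((c x ^ 2 - 2 * t * c x) + t ^ 2) ∂P := by
      congr 1 with x
      ring
    have h2 : Integrable (fun x => c x ^ 2 - 2 * t * c x) (P.restrict A) :=
      hc2.integrableOn.sub (hc.integrableOn.const_mul _)
    rw [h1, integral_add h2 (integrable_const _), integral_sub hc2.integrableOn (hc.integrableOn.const_mul _),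
      integral_const_mul, setIntegral_const, smul_eq_mul] at h0
    linarith
  have := discrim_le_zero h
  rw [discrim] at this
  linarith

variable {H : Type u} [NormedAddCommGroup H] [InnerProductSpace ℂ H] [CompleteSpace H]
  {F : Ω → H}

/-- With `w = ρ v` one has `‖w‖² = ∫ ⟨F x, v⟩ ⟨w, F x⟩`. Expanding `w` once more as an integral
brings in the overlaps `⟨F x, F x'⟩`, and their bound depends only on the two classes. -/
lemma norm_integral_ketBra_apply_sq_le (hF : AEStronglyMeasurable F P) (h1 : ∀ x, ‖F x‖ = 1)
    (hcls : Measurable cls) {G : Fin 3 → Fin 3 → ℝ}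
    (hG : ∀ᵐ x ∂P, ∀ᵐ x' ∂P, ‖inner ℂ (F x) (F x')‖ ≤ G (cls x) (cls x')) (v : H) :
    ‖(∫ x, ketBra (F x) ∂P) v‖ ^ 2 ≤
      ∑ j, ∑ k, (∫ x in cls ⁻¹' {j}, ‖inner ℂ (F x) v‖ ∂P) *
        (∫ x in cls ⁻¹' {k}, ‖inner ℂ (F x) v‖ ∂P) * G j k := by
  set c : Ω → ℝ := fun x => ‖inner ℂ (F x) v‖ with hcdef
  set C : Fin 3 → ℝ := fun j => ∫ x in cls ⁻¹' {j}, c x ∂P with hC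
  have hc : Integrable c P := integrable_norm_inner hF h1 v
  set w := (∫ x, ketBra (F x) ∂P) v with hw
  have hwint : w = ∫ x, inner ℂ (F x) v • F x ∂P := integral_ketBra_apply hF h1 v
  have hx : ∀ᵐ x ∂P, ‖inner ℂ (F x) w‖ ≤ ∑ k, C k * G (cls x) k := by
    filter_upwards [hG] with x hx
    rw [hwint, ← integral_inner (integrable_inner_smul hF h1 v),
      ← integral_mul_comp hcls hc (G (cls x))]
    refine norm_integral_le_of_norm_le (integrable_mul_comp hcls hc _) ?_
    filter_upwards [hx] with x' hx'
    rw [inner_smul_right, norm_mul]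
    gcongr
  have hself : ‖w‖ ^ 2 = ‖∫ x, inner ℂ w (inner ℂ (F x) v • F x) ∂P‖ := by
    rw [integral_inner (integrable_inner_smul hF h1 v), ← hwint, inner_self_eq_norm_sq_to_K,
      norm_pow]
    simp
  rw [hself]
  calc _ ≤ ∫ x, c x * ∑ k, C k * G (cls x) k ∂P := by
        refine norm_integral_le_of_norm_le
          (integrable_mul_comp hcls hc fun j => ∑ k, C k * G j k) ?_
        filter_upwards [hx] with x hx
        rw [inner_smul_right, norm_mul, norm_inner_symm w]
        gcongr
    _ = _ := by
        rw [integral_mul_comp hcls hc fun j => ∑ k, C k * G j k]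
        simp_rw [Finset.mul_sum, mul_assoc]
        rfl

/-- If the overlaps of an ensemble are dominated classwise by `G`, the eigenvalues of the ensemble
state are dominated by any bound on the weighted quadratic form of `G`. -/
theorem eigenvalue_integral_ketBra_le (hF : AEStronglyMeasurable F P) (h1 : ∀ x, ‖F x‖ = 1)
    (hcls : Measurable cls) {G : Fin 3 → Fin 3 → ℝ} (hG0 : ∀ j k, 0 ≤ G j k)
    (hG : ∀ᵐ x ∂P, ∀ᵐ x' ∂P, ‖inner ℂ (F x) (F x')‖ ≤ G (cls x) (cls x')) {l : ℝ}
    (hl : ∀ N : Fin 3 → ℝ, ∑ j, ∑ k, (√(P.real (cls ⁻¹' {j})) * N j) *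
      (√(P.real (cls ⁻¹' {k})) * N k) * G j k ≤ l * ∑ j, N j ^ 2) (hl0 : 0 ≤ l)
    {μ : ℝ} {v : H} (hv : ‖v‖ = 1) (hμ : (∫ x, ketBra (F x) ∂P) v = (μ : ℂ) • v) : μ ≤ l := by
  set c : Ω → ℝ := fun x => ‖inner ℂ (F x) v‖ with hcdef
  have hc : Integrable c P := integrable_norm_inner hF h1 v
  have hc2 : Integrable (fun x => c x ^ 2) P := integrable_norm_sq_inner hF h1 v
  have hμe : μ = ∫ x, c x ^ 2 ∂P := spec_eq_integral hF h1 hv hμ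
  have hμ0 : 0 ≤ μ := by rw [hμe]; exact integral_nonneg fun x => by positivity
  set N : Fin 3 → ℝ := fun j => √(∫ x in cls ⁻¹' {j}, c x ^ 2 ∂P) with hN
  have hNsum : ∑ j, N j ^ 2 = μ := by
    have h := integral_mul_comp (cls := cls) hcls hc2 fun _ => (1 : ℝ)
    simp only [mul_one] at h
    rw [hμe, h]
    exact Finset.sum_congr rfl fun j _ => Real.sq_sqrt (integral_nonneg fun x => by positivity)
  have h := norm_integral_ketBra_apply_sq_le hF h1 hcls hG v
  rw [hμ, norm_smul, hv, mul_one, Complex.norm_real, Real.norm_of_nonneg hμ0] at h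
  -- The class integrals of `c` are at most `√π_j · N j` by Cauchy–Schwarz; the Gram bound then
  -- applies at `N`, whose squared norm is `μ`.
  have h2 : μ ^ 2 ≤ l * μ := by
    refine h.trans (le_trans ?_ ((hl N).trans_eq (by rw [hNsum])))
    refine Finset.sum_le_sum fun j _ => Finset.sum_le_sum fun k _ =>
      mul_le_mul_of_nonneg_right ?_ (hG0 j k)
    exact mul_le_mul (setIntegral_le_sqrt_mul_sqrt hc hc2 _) (setIntegral_le_sqrt_mul_sqrt hc hc2 _)
      (integral_nonneg fun x => norm_nonneg _) (by positivity)
  by_contra hlt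
  push Not at hlt
  nlinarith

end ClassBound

/-! ### The Gram form of the retrocausal states -/

section Retro

/-- Since these overlaps are nonnegative reals, the Gram matrix equals the matrix of its moduli. The
entrywise upper bound for all models is thus itself a Gram matrix. -/
lemma inner_retroState (q : ℝ) (j k : Fin 3) :
    inner ℂ (retroState q j) (retroState q k) =
      ((‖inner ℂ (retroState q j) (retroState q k)‖ : ℝ) : ℂ) := by
  fin_cases j <;> fin_cases k <;>
    simp [retroState, PiLp.inner_apply, Fin.sum_univ_two, abs_of_nonneg, Real.sqrt_nonneg]

lemma norm_retroState {q : ℝ} (hq : q ∈ Set.Icc (0 : ℝ) 1) (j : Fin 3) : ‖retroState q j‖ = 1 := by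
  have h : 0 ≤ 1 - q := by linarith [hq.2]
  fin_cases j <;> simp [retroState, EuclideanSpace.norm_eq, Fin.sum_univ_two, Real.sq_sqrt, hq.1, h]

lemma mixture_apply {H : Type*} [NormedAddCommGroup H] [InnerProductSpace ℂ H] (w : Fin 3 → ℝ)
    (ψ : Fin 3 → H) (v : H) : mixture w ψ v = ∑ j, (w j : ℂ) • inner ℂ (ψ j) v • ψ j := by
  simp [mixture]

lemma inner_mixture {H : Type*} [NormedAddCommGroup H] [InnerProductSpace ℂ H] (w : Fin 3 → ℝ)
    (ψ : Fin 3 → H) (v : H) :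
    inner ℂ v (mixture w ψ v) = ((∑ j, w j * ‖inner ℂ (ψ j) v‖ ^ 2 : ℝ) : ℂ) := by
  rw [mixture_apply, inner_sum, Complex.ofReal_sum]
  refine Finset.sum_congr rfl fun j _ => ?_
  rw [inner_smul_right, inner_smul_right, ← inner_conj_symm v (ψ j), Complex.mul_conj']
  push_cast
  rfl

lemma isSymmetric_mixture {H : Type*} [NormedAddCommGroup H] [InnerProductSpace ℂ H]
    (w : Fin 3 → ℝ) (ψ : Fin 3 → H) : (mixture w ψ).IsSymmetric := by
  intro v x
  change inner ℂ (mixture w ψ v) x = inner ℂ v (mixture w ψ x)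
  simp only [mixture_apply, inner_sum, sum_inner, inner_smul_left, inner_smul_right,
    inner_conj_symm, Complex.conj_ofReal]
  exact Finset.sum_congr rfl fun j _ => by ring

/-- The largest eigenvalue of the ensemble state of the retrocausal model bounds its Gram form. -/
lemma exists_eigenvalue_bound (q : ℝ) {w : Fin 3 → ℝ} (hw : ∀ j, 0 ≤ w j) :
    ∃ l : ℝ, 0 ≤ l ∧ Module.End.HasEigenvalue
        (mixture w (retroState q) : EuclideanSpace ℂ (Fin 2) →ₗ[ℂ] _) (l : ℂ) ∧
      ∀ N : Fin 3 → ℝ, ∑ j, ∑ k, (√(w j) * N j) * (√(w k) * N k) *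
        ‖inner ℂ (retroState q j) (retroState q k)‖ ≤ l * ∑ j, N j ^ 2 := by
  set T := mixture w (retroState q) with hT
  have hsymm : T.IsSymmetric := isSymmetric_mixture _ _
  have heig := hsymm.hasEigenvalue_iSup_of_finiteDimensional
  -- The supremum of the Rayleigh quotient, which in finite dimension is an eigenvalue.
  set l : ℝ := ⨆ x : { x : EuclideanSpace ℂ (Fin 2) // x ≠ 0 },
    RCLike.re (inner ℂ (T x) (x : EuclideanSpace ℂ (Fin 2))) / ‖(x : EuclideanSpace ℂ (Fin 2))‖ ^ 2
    with hl
  have hre : ∀ x, RCLike.re (inner ℂ (T x) x) = ∑ j, w j * ‖inner ℂ (retroState q j) x‖ ^ 2 := by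
    intro x
    have h : inner ℂ (T x) x = inner ℂ x (T x) := hsymm x x
    rw [h, inner_mixture]
    exact Complex.ofReal_re _
  have hray : ∀ x, ∑ j, w j * ‖inner ℂ (retroState q j) x‖ ^ 2 ≤ l * ‖x‖ ^ 2 := by
    intro x
    by_cases hx : x = 0
    · simp [hx]
    rw [← hre, ← div_le_iff₀ (by positivity)]
    refine le_ciSup (f := fun x : { x : EuclideanSpace ℂ (Fin 2) // x ≠ 0 } =>
      RCLike.re (inner ℂ (T x) (x : EuclideanSpace ℂ (Fin 2))) /
        ‖(x : EuclideanSpace ℂ (Fin 2))‖ ^ 2) ?_ ⟨x, hx⟩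
    refine ⟨‖T‖, ?_⟩
    rintro _ ⟨⟨y, hy⟩, rfl⟩
    change _ / _ ≤ _
    rw [div_le_iff₀ (by positivity)]
    calc _ ≤ ‖inner ℂ (T y) y‖ := RCLike.re_le_norm _
      _ ≤ ‖T y‖ * ‖y‖ := norm_inner_le_norm _ _
      _ ≤ ‖T‖ * ‖y‖ * ‖y‖ := by gcongr; exact T.le_opNorm y
      _ = _ := by ring
  have hl0 : 0 ≤ l := by
    refine Real.iSup_nonneg fun x => ?_
    rw [hre]
    exact div_nonneg (Finset.sum_nonneg fun j _ => mul_nonneg (hw j) (by positivity))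
      (by positivity)
  refine ⟨l, hl0, heig, fun N => ?_⟩
  -- The Gram form at `N` is `‖y‖²`. Pairing one copy of `y` with the sum and using Cauchy–Schwarz
  -- gives `‖y‖⁴ ≤ (∑ N²) · l ‖y‖²`: the weighted Gram matrix obeys the same bound as the mixture.
  set y : EuclideanSpace ℂ (Fin 2) := ∑ j, ((√(w j) * N j : ℝ) : ℂ) • retroState q j with hy
  have hyy : ‖y‖ ^ 2 = ∑ j, ∑ k, (√(w j) * N j) * (√(w k) * N k) *
        ‖inner ℂ (retroState q j) (retroState q k)‖ := by
    have h : ((‖y‖ ^ 2 : ℝ) : ℂ) = inner ℂ y y := by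
      rw [inner_self_eq_norm_sq_to_K]; norm_cast
    apply Complex.ofReal_injective
    rw [h, hy]
    simp only [inner_sum, sum_inner, inner_smul_left, inner_smul_right, Complex.conj_ofReal]
    push_cast
    rw [Finset.sum_comm]
    refine Finset.sum_congr rfl fun j _ => ?_
    rw [Finset.mul_sum]
    refine Finset.sum_congr rfl fun k _ => ?_
    linear_combination (√(w j) * N j * (√(w k) * N k) : ℂ) * inner_retroState q k j
  rw [← hyy]
  have h2 : ‖y‖ ^ 2 ≤ ∑ j, |N j| * (√(w j) * ‖inner ℂ (retroState q j) y‖) := by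
    have h : ((‖y‖ ^ 2 : ℝ) : ℂ) = inner ℂ y y := by
      rw [inner_self_eq_norm_sq_to_K]; norm_cast
    have h3 : ‖y‖ ^ 2 = ‖inner ℂ y y‖ := by
      rw [← h, Complex.norm_real, Real.norm_of_nonneg (by positivity)]
    have h4 : inner ℂ y y = ∑ j, ((√(w j) * N j : ℝ) : ℂ) * inner ℂ (retroState q j) y := by
      conv_lhs => arg 2; rw [hy]
      simp only [sum_inner, inner_smul_left, Complex.conj_ofReal]
    rw [h3, h4]
    refine (norm_sum_le _ _).trans (Finset.sum_le_sum fun j _ => le_of_eq ?_)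
    rw [norm_mul, Complex.norm_real, Real.norm_eq_abs, abs_mul, abs_of_nonneg (Real.sqrt_nonneg _)]
    ring
  have h3 : (‖y‖ ^ 2) ^ 2 ≤ (∑ j, N j ^ 2) * (l * ‖y‖ ^ 2) := by
    calc (‖y‖ ^ 2) ^ 2 ≤ (∑ j, |N j| * (√(w j) * ‖inner ℂ (retroState q j) y‖)) ^ 2 := by gcongr
      _ ≤ (∑ j, |N j| ^ 2) * ∑ j, (√(w j) * ‖inner ℂ (retroState q j) y‖) ^ 2 :=
          Finset.sum_mul_sq_le_sq_mul_sq _ _ _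
      _ ≤ _ := by
          simp_rw [sq_abs, mul_pow]
          gcongr
          simpa only [Real.sq_sqrt (hw _)] using hray y
  by_cases hy0 : ‖y‖ ^ 2 = 0
  · rw [hy0]; positivity
  have hpos : 0 < ‖y‖ ^ 2 := lt_of_le_of_ne (by positivity) (Ne.symm hy0)
  nlinarith

end Retro

/-! ### Majorization and entropy of probability families -/

section Families

variable {ι κ : Type*} {a : ι → ℝ} {b : κ → ℝ}

lemma bddAbove_sum_card_le (ha : ∀ i, 0 ≤ a i) (hs : HasSum a 1) (n : ℕ) :
    BddAbove (Set.range fun s : {s : Finset ι // s.card ≤ n} => ∑ i ∈ s.1, a i) := by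
  refine ⟨1, ?_⟩
  rintro _ ⟨s, rfl⟩
  exact sum_le_hasSum _ (fun i _ => ha i) hs

/-- A probability vector with at most two entries majorizes every probability family whose members
do not exceed its largest entry. -/
lemma majorizes_of_card_le_two [Fintype ι] (hι : Fintype.card ι ≤ 2) (ha : ∀ i, 0 ≤ a i)
    (hs : HasSum a 1) (i₀ : ι) (hb : ∀ k, 0 ≤ b k) (hb1 : HasSum b 1) (hle : ∀ k, b k ≤ a i₀) :
    Majorizes a b := by
  refine ⟨fun n => ?_, 1, hs, hb1⟩
  have : Nonempty {s : Finset κ // s.card ≤ n} := ⟨⟨∅, by simp⟩⟩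
  refine ciSup_le fun s => ?_
  have hbdd := bddAbove_sum_card_le ha hs n
  -- For `n = 1` the largest entry suffices; from `n = 2` on, all of `a` is available and already
  -- sums to one.
  match n, s, hbdd with
  | 0, ⟨s, h⟩, hbdd =>
    obtain rfl : s = ∅ := Finset.card_eq_zero.1 (Nat.le_zero.1 h)
    exact le_ciSup_of_le hbdd ⟨∅, by simp⟩ (by simp)
  | 1, ⟨s, h⟩, hbdd =>
    refine le_ciSup_of_le hbdd ⟨{i₀}, by simp⟩ ?_
    simp only [Finset.sum_singleton]
    rcases Nat.le_one_iff_eq_zero_or_eq_one.1 h with h | h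
    · rw [Finset.card_eq_zero.1 h]
      simpa using ha i₀
    · obtain ⟨k, rfl⟩ := Finset.card_eq_one.1 h
      simpa using hle k
  | n + 2, ⟨s, h⟩, hbdd =>
    refine le_ciSup_of_le hbdd ⟨Finset.univ, by rw [Finset.card_univ]; omega⟩ ?_
    rw [(hasSum_fintype a).unique hs]
    exact sum_le_hasSum _ (fun i _ => hb i) hb1

/-- For `c k` one takes minus the logarithm of an upper bound of `b k`. This replaces a possibly
divergent entropy by a series with a known sum. -/
lemma ofReal_le_tsum_negMulLog {c : κ → ℝ} {s : ℝ} (h0 : ∀ k, 0 ≤ b k * c k)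
    (hc : ∀ k, b k * c k ≤ Real.negMulLog (b k)) (hs : HasSum (fun k => b k * c k) s) :
    ENNReal.ofReal s ≤ ∑' k, ENNReal.ofReal (Real.negMulLog (b k)) := by
  rw [← hs.tsum_eq, ENNReal.ofReal_tsum_of_nonneg h0 hs.summable]
  exact ENNReal.tsum_le_tsum fun k => ENNReal.ofReal_le_ofReal (hc k)

lemma mul_neg_log_le_negMulLog {x y : ℝ} (hx : 0 ≤ x) (hxy : x ≤ y) :
    x * -Real.log y ≤ Real.negMulLog x := by
  rcases hx.eq_or_lt with rfl | hx
  · simp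
  · rw [Real.negMulLog, neg_mul, mul_neg, neg_le_neg_iff]
    exact mul_le_mul_of_nonneg_left (Real.log_le_log hx hxy) hx.le

/-- The entropy of a probability family with members at most `l ≥ 1/2` is at least the binary
entropy of `l`. -/
lemma binEntropy_le_tsum_negMulLog (hb : ∀ k, 0 ≤ b k) (hb1 : HasSum b 1) {l : ℝ}
    (hl : 2⁻¹ ≤ l) (hl1 : l ≤ 1) (hle : ∀ k, b k ≤ l) :
    ENNReal.ofReal (Real.binEntropy l) ≤ ∑' k, ENNReal.ofReal (Real.negMulLog (b k)) := by
  classical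
  -- If some member `m` is at least `1/2`, then `binEntropy l ≤ binEntropy m` by monotonicity, and
  -- all other members are at most `1 - m`. If none is, every `-log (b k)` with `b k > 0` is at
  -- least `log 2`.
  by_cases h : ∃ k, 2⁻¹ ≤ b k
  · obtain ⟨k₀, hk₀⟩ := h
    have hm1 : b k₀ ≤ 1 := (hle k₀).trans hl1
    have hother : ∀ k, k ≠ k₀ → b k ≤ 1 - b k₀ := by
      intro k hk
      have := sum_le_hasSum {k, k₀} (fun i _ => hb i) hb1
      rw [Finset.sum_pair hk] at this
      linarith
    refine (ENNReal.ofReal_le_ofReal (Real.binEntropy_strictAntiOn.antitoneOn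
      ⟨hk₀, hm1⟩ ⟨hl, hl1⟩ (hle k₀))).trans ?_
    refine ofReal_le_tsum_negMulLog
      (c := fun k => if k = k₀ then -Real.log (b k₀) else -Real.log (1 - b k₀)) ?_ ?_ ?_
    · intro k
      refine mul_nonneg (hb k) ?_
      split_ifs
      · exact neg_nonneg.2 (Real.log_nonpos (hb _) hm1)
      · exact neg_nonneg.2 (Real.log_nonpos (by linarith) (by linarith [hb k₀]))
    · intro k
      by_cases hk : k = k₀
      · subst hk
        simpa using mul_neg_log_le_negMulLog (hb k) le_rfl
      · simpa [hk] using mul_neg_log_le_negMulLog (hb k) (hother k hk)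
    -- The constant weight `-log (1 - b k₀)` everywhere, plus a correction at `k₀`.
    · have h1 := (hb1.mul_right (-Real.log (1 - b k₀))).add
        (hasSum_ite_eq k₀ (b k₀ * (-Real.log (b k₀) + Real.log (1 - b k₀))))
      have h2 : Real.binEntropy (b k₀) = 1 * -Real.log (1 - b k₀) +
          b k₀ * (-Real.log (b k₀) + Real.log (1 - b k₀)) := by
        rw [Real.binEntropy_eq_negMulLog_add_negMulLog_one_sub, Real.negMulLog, Real.negMulLog]
        ring
      rw [h2]
      convert! h1 using 2 with k
      by_cases hk : k = k₀
      · subst hk; simp; ring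
      · simp [hk]
  · push Not at h
    refine (ENNReal.ofReal_le_ofReal Real.binEntropy_le_log_two).trans ?_
    have hlog : 0 ≤ Real.log 2 := Real.log_nonneg (by norm_num)
    refine ofReal_le_tsum_negMulLog (c := fun _ => Real.log 2)
      (fun k => mul_nonneg (hb k) hlog) (fun k => ?_) ?_
    · have := mul_neg_log_le_negMulLog (hb k) (h k).le
      rwa [Real.log_inv, neg_neg] at this
    · simpa using hb1.mul_right (Real.log 2)

lemma tsum_negMulLog_le_binEntropy [Fintype ι] (hι : Fintype.card ι ≤ 2) (ha : ∀ i, 0 ≤ a i)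
    (hs : HasSum a 1) (i₀ : ι) :
    ∑' i, ENNReal.ofReal (Real.negMulLog (a i)) ≤ ENNReal.ofReal (Real.binEntropy (a i₀)) := by
  classical
  have hsum : ∑ i, a i = 1 := (hasSum_fintype a).unique hs
  have ha1 : ∀ i, a i ≤ 1 := fun i => le_hasSum hs i fun j _ => ha j
  rw [tsum_fintype, ← Finset.add_sum_erase _ _ (Finset.mem_univ i₀),
    Real.binEntropy_eq_negMulLog_add_negMulLog_one_sub,
    ENNReal.ofReal_add (Real.negMulLog_nonneg (ha _) (ha1 _))
      (Real.negMulLog_nonneg (by linarith [ha1 i₀]) (by linarith [ha i₀]))]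
  rw [← Finset.add_sum_erase _ _ (Finset.mem_univ i₀)] at hsum
  gcongr
  have hcard : (Finset.univ.erase i₀).card ≤ 1 := by
    rw [Finset.card_erase_of_mem (Finset.mem_univ _), Finset.card_univ]; omega
  rcases Nat.le_one_iff_eq_zero_or_eq_one.1 hcard with h | h
  · rw [Finset.card_eq_zero.1 h]
    simp
  · obtain ⟨k, hk⟩ := Finset.card_eq_one.1 h
    rw [hk, Finset.sum_singleton] at hsum ⊢
    rw [← hsum, add_sub_cancel_left]

end Families

/-! ### Comparing ensembles with the retrocausal one -/

section Comparison

variable {Ω : Type*} [MeasurableSpace Ω] {P : Measure Ω} [IsProbabilityMeasure P]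
  {cls : Ω → Fin 3}

/-- Puts finite ensembles, that of `Q⁻` included, within reach of the results on integrals. -/
lemma integral_ketBra_comp {H : Type*} [NormedAddCommGroup H] [InnerProductSpace ℂ H]
    [CompleteSpace H] (hcls : Measurable cls) (ψ : Fin 3 → H) :
    ∫ x, ketBra (ψ (cls x)) ∂P = mixture (fun j => P.real (cls ⁻¹' {j})) ψ := by
  have h : ∫ x, ketBra (ψ (cls x)) ∂P = ∫ j, ketBra (ψ j) ∂(P.map cls) :=
    (integral_map (f := fun j => ketBra (ψ j)) hcls.aemeasurable
      (StronglyMeasurable.of_discrete.aestronglyMeasurable)).symm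
  have : IsProbabilityMeasure (P.map cls) := Measure.isProbabilityMeasure_map hcls.aemeasurable
  rw [h, integral_fintype Integrable.of_finite, mixture]
  refine Finset.sum_congr rfl fun j _ => ?_
  rw [map_measureReal_apply hcls (measurableSet_singleton j)]
  ext v
  simp

lemma card_specIndex_le {H : Type*} [NormedAddCommGroup H] [InnerProductSpace ℂ H]
    [FiniteDimensional ℂ H] {T : H →L[ℂ] H} (hT : T.IsSymmetric) :
    ∃ _ : Fintype (SpecIndex T), Fintype.card (SpecIndex T) ≤ Module.finrank ℂ H := by
  obtain ⟨b, hb, -, -⟩ := exists_orthonormal_eigenvectors hT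
  have : Finite (SpecIndex T) := hb.linearIndependent.finite
  exact ⟨Fintype.ofFinite _, @LinearIndependent.fintype_card_le_finrank _ _ _ _ _ _ _ _ (_) _
    hb.linearIndependent⟩

lemma exists_specIndex_of_hasEigenvalue {H : Type*} [NormedAddCommGroup H] [InnerProductSpace ℂ H]
    [FiniteDimensional ℂ H] {T : H →L[ℂ] H} {l : ℝ}
    (hl : Module.End.HasEigenvalue (T : H →ₗ[ℂ] H) (l : ℂ)) : ∃ i, spec T i = l := by
  have : 0 < Module.finrank ℂ (Module.End.eigenspace (T : H →ₗ[ℂ] H) (l : ℂ)) := by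
    rw [Nat.pos_iff_ne_zero, ne_eq, Submodule.finrank_eq_zero]
    exact hl
  exact ⟨⟨l, ⟨0, this⟩⟩, rfl⟩

lemma spec_le_of_eigenvalue_le {H : Type*} [NormedAddCommGroup H] [InnerProductSpace ℂ H]
    {T : H →L[ℂ] H} (hT : T.IsSymmetric) {l : ℝ}
    (h : ∀ (μ : ℝ) (v : H), ‖v‖ = 1 → T v = (μ : ℂ) • v → μ ≤ l) (i : SpecIndex T) :
    spec T i ≤ l := by
  obtain ⟨b, hb, hbe, -⟩ := exists_orthonormal_eigenvectors hT
  exact h _ _ (hb.1 i) (hbe i)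

/-- Among probability families bounded by the largest entry of a two-entry probability vector,
that vector majorizes and has least entropy. -/
lemma majorizes_and_entropy_le {ι κ : Type*} {a : ι → ℝ} {b : κ → ℝ} [Fintype ι]
    (hι : Fintype.card ι ≤ 2) (ha : ∀ i, 0 ≤ a i) (hs : HasSum a 1) (i₀ : ι)
    (hmax : ∀ i, a i ≤ a i₀) (hb : ∀ k, 0 ≤ b k) (hb1 : HasSum b 1) (hle : ∀ k, b k ≤ a i₀) :
    Majorizes a b ∧ ∑' i, ENNReal.ofReal (Real.negMulLog (a i)) ≤
      ∑' k, ENNReal.ofReal (Real.negMulLog (b k)) := by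
  refine ⟨majorizes_of_card_le_two hι ha hs i₀ hb hb1 hle, ?_⟩
  have hl1 : a i₀ ≤ 1 := le_hasSum hs i₀ fun j _ => ha j
  have hhalf : 2⁻¹ ≤ a i₀ := by
    have h2 : ∑ i, a i = 1 := (hasSum_fintype _).unique hs
    have h3 : ∑ i, a i ≤ Fintype.card ι * a i₀ := by
      simpa using Finset.sum_le_card_nsmul Finset.univ _ (a i₀) fun i _ => hmax i
    have h4 : (Fintype.card ι : ℝ) ≤ 2 := by exact_mod_cast hι
    nlinarith [ha i₀]
  exact (tsum_negMulLog_le_binEntropy hι ha hs i₀).trans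
    (binEntropy_le_tsum_negMulLog hb hb1 hhalf hl1 hle)

/-- The spectrum of the ensemble state of the retrocausal model. -/
lemma spec_retro_mixture {q : ℝ} (hq : q ∈ Set.Icc (0 : ℝ) 1) (hcls : Measurable cls)
    {w : Fin 3 → ℝ} (hw : w = fun j => P.real (cls ⁻¹' {j})) :
    (∀ i, 0 ≤ spec (mixture w (retroState q)) i) ∧ HasSum (spec (mixture w (retroState q))) 1 := by
  have hFR : AEStronglyMeasurable (fun x => retroState q (cls x)) P :=
    (Measurable.of_discrete.comp hcls).stronglyMeasurable.aestronglyMeasurable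
  have h := spec_integral_ketBra hFR fun x => norm_retroState hq (cls x)
  rwa [integral_ketBra_comp hcls, ← hw] at h

variable {H : Type u} [NormedAddCommGroup H] [InnerProductSpace ℂ H] [CompleteSpace H]
  {F : Ω → H}

/-- The ensemble state of the retrocausal model majorizes, and has at most the entropy of, every
ensemble state whose overlaps are classwise dominated. -/
theorem retro_majorizes_and_entropy_le {q : ℝ} (hq : q ∈ Set.Icc (0 : ℝ) 1)
    (hF : AEStronglyMeasurable F P) (h1 : ∀ x, ‖F x‖ = 1) (hcls : Measurable cls)
    {w : Fin 3 → ℝ} (hw : w = fun j => P.real (cls ⁻¹' {j}))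
    (hG : ∀ᵐ x ∂P, ∀ᵐ x' ∂P, ‖inner ℂ (F x) (F x')‖ ≤
      ‖inner ℂ (retroState q (cls x)) (retroState q (cls x'))‖) :
    Majorizes (spec (mixture w (retroState q))) (spec (∫ x, ketBra (F x) ∂P)) ∧
      vonNeumannEntropy (mixture w (retroState q)) ≤
        vonNeumannEntropy (∫ x, ketBra (F x) ∂P) := by
  have hw0 : ∀ j, 0 ≤ w j := fun j => hw ▸ measureReal_nonneg
  obtain ⟨l, hl0, hl, hbound⟩ := exists_eigenvalue_bound q hw0
  let G : Fin 3 → Fin 3 → ℝ := fun j k => ‖inner ℂ (retroState q j) (retroState q k)‖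
  have hG0 : ∀ j k, 0 ≤ G j k := fun j k => norm_nonneg _
  have hbound' : ∀ N : Fin 3 → ℝ, ∑ j, ∑ k, (√(P.real (cls ⁻¹' {j})) * N j) *
      (√(P.real (cls ⁻¹' {k})) * N k) * G j k ≤ l * ∑ j, N j ^ 2 := by
    simpa only [hw] using hbound
  obtain ⟨hR0, hR1⟩ := spec_retro_mixture hq hcls hw
  obtain ⟨h0, hs1⟩ := spec_integral_ketBra hF h1
  have hsymm : (mixture w (retroState q)).IsSymmetric := isSymmetric_mixture _ _
  have hle : ∀ i, spec (∫ x, ketBra (F x) ∂P) i ≤ l :=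
    spec_le_of_eigenvalue_le (isSymmetric_integral_ketBra hF h1) fun μ v hv hμ =>
      eigenvalue_integral_ketBra_le hF h1 hcls (G := G) hG0 hG hbound' hl0 hv hμ
  -- The retrocausal ensemble satisfies the overlap bound with equality, so the same estimate shows
  -- that `l` is its largest eigenvalue.
  have hleR : ∀ i, spec (mixture w (retroState q)) i ≤ l := by
    have hFR : AEStronglyMeasurable (fun x => retroState q (cls x)) P :=
      (Measurable.of_discrete.comp hcls).stronglyMeasurable.aestronglyMeasurable
    refine spec_le_of_eigenvalue_le hsymm fun μ v hv hμ => ?_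
    rw [hw, ← integral_ketBra_comp hcls] at hμ
    exact eigenvalue_integral_ketBra_le hFR (fun x => norm_retroState hq (cls x)) hcls (G := G)
      hG0 (Filter.Eventually.of_forall fun x => Filter.Eventually.of_forall fun x' => le_refl _)
      hbound' hl0 hv hμ
  obtain ⟨i₀, rfl⟩ := exists_specIndex_of_hasEigenvalue hl
  obtain ⟨_, hcard⟩ := card_specIndex_le hsymm
  rw [finrank_euclideanSpace_fin] at hcard
  exact majorizes_and_entropy_le hcard hR0 hR1 i₀ hleR h0 hs1 hle

end Comparison

/-! ### The reversed heralding coin as a Markov chain -/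

section Coin

/-- The transition probabilities of the time-reversed heralding coin. -/
def reverseStep (p q : ℝ) : Fin 3 → Fin 3 → ℝ :=
  ![![1 - p, 0, p], ![q * (1 - p), 1 - q, q * p], ![0, 1, 0]]

/-- The symbol of the heralding coin determined by two consecutive symbols of the coin. -/
def heraldPair (i j : Fin 2) : Fin 3 := if j = 1 then 1 else if i = 1 then 2 else 0

/-- The symbols `c₀ c₁ …` of the coin. -/
def tail (c : ℤ → Fin 2) : ℕ → Fin 2 := fun n => c n

/-- The heralding symbols `x₀ x₁ …` determined by `c₋₁ = j` and `z = c₀ c₁ …`. -/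
def heraldTail (j : Fin 2) (z : ℕ → Fin 2) : ℕ → Fin 3
  | 0 => heraldPair j (z 0)
  | n + 1 => heraldPair (z n) (z (n + 1))

lemma herald_eq (c : ℤ → Fin 2) (t : ℤ) : herald c t = heraldPair (c (t - 1)) (c t) := rfl

/-- Position `n` of the reversed past is `x_n`, so this past involves the coin only from `c₋₁` on.
-/
lemma past_timeReverse_herald (c : ℤ → Fin 2) :
    past (timeReverse (herald c)) = heraldTail (c (-1)) (tail c) := by
  ext1 n
  have h : past (timeReverse (herald c)) n = herald c n := by
    simp only [past, timeReverse]
    congr 1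
    ring
  rw [h, herald_eq]
  cases n with
  | zero => rfl
  | succ n => simp [heraldTail, tail]

lemma measurable_tail : Measurable tail :=
  measurable_pi_iff.2 fun _ => measurable_pi_apply _

lemma measurable_heraldTail (j : Fin 2) : Measurable (heraldTail j) := by
  refine measurable_pi_iff.2 fun n => ?_
  cases n with
  | zero => exact (Measurable.of_discrete (f := heraldPair j)).comp (measurable_pi_apply 0)
  | succ n =>
    have h : Measurable fun z : ℕ → Fin 2 => (z n, z (n + 1)) :=
      (measurable_pi_apply n).prodMk (measurable_pi_apply (n + 1))
    exact (Measurable.of_discrete (f := fun x : Fin 2 × Fin 2 => heraldPair x.1 x.2)).comp h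

lemma measurable_herald : Measurable herald := by
  refine measurable_pi_iff.2 fun t => ?_
  have h : Measurable fun c : ℤ → Fin 2 => (c (t - 1), c t) :=
    (measurable_pi_apply (t - 1)).prodMk (measurable_pi_apply t)
  exact (Measurable.of_discrete (f := fun x : Fin 2 × Fin 2 => heraldPair x.1 x.2)).comp h

lemma measurable_timeReverse {A : Type*} [MeasurableSpace A] :
    Measurable (timeReverse : (ℤ → A) → ℤ → A) :=
  measurable_pi_iff.2 fun _ => measurable_pi_apply _

lemma measurableSet_coordinate {ι A : Type*} [MeasurableSpace A] [MeasurableSingletonClass A]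
    (t : ι) (a : A) : MeasurableSet {c : ι → A | c t = a} := by
  have h : Measurable fun c : ι → A => c t := measurable_pi_apply t
  exact h (measurableSet_singleton a)

lemma measurable_past {A : Type*} [MeasurableSpace A] : Measurable (past : (ℤ → A) → ℕ → A) :=
  measurable_pi_iff.2 fun _ => measurable_pi_apply _

lemma measurable_timeReverse_herald :
    Measurable fun c : ℤ → Fin 2 => timeReverse (herald c) :=
  measurable_timeReverse.comp measurable_herald

lemma reversedHeraldingLaw_eq (coin : Measure (ℤ → Fin 2)) :
    reversedHeraldingLaw coin = coin.map fun c => timeReverse (herald c) :=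
  Measure.map_map measurable_timeReverse measurable_herald

instance (coin : Measure (ℤ → Fin 2)) [IsProbabilityMeasure coin] :
    IsProbabilityMeasure (reversedHeraldingLaw coin) := by
  rw [reversedHeraldingLaw_eq]
  exact Measure.isProbabilityMeasure_map measurable_timeReverse_herald.aemeasurable

/-- Finite measures on sequences over a finite alphabet are determined by initial cylinders. -/
lemma ext_of_initial_cylinders {A : Type*} [Finite A] [MeasurableSpace A]
    [MeasurableSingletonClass A] {μ ν : Measure (ℕ → A)} [IsFiniteMeasure μ] [IsFiniteMeasure ν]
    (h : ∀ (n : ℕ) (w : ℕ → A), μ {z | ∀ i ≤ n, z i = w i} = ν {z | ∀ i ≤ n, z i = w i}) :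
    μ = ν := by
  -- Both measures are projective limits of the marginals of `ν`, and such a limit is unique.
  let Q : (I : Finset ℕ) → Measure (∀ _ : I, A) := fun I => ν.map I.restrict
  have hQ : IsProjectiveMeasureFamily (α := fun _ : ℕ => A) Q := by
    intro I J hJI
    simp only [Q]
    rw [Measure.map_map (Finset.measurable_restrict₂ hJI) (Finset.measurable_restrict I)]
    rfl
  have hν : IsProjectiveLimit (α := fun _ : ℕ => A) ν Q := fun I => rfl
  refine IsProjectiveLimit.unique (α := fun _ : ℕ => A) (P := Q) ?_ hν
  rw [isProjectiveLimit_nat_iff hQ]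
  intro n
  refine Measure.ext_of_singleton fun a => ?_
  have hn : Measurable (Preorder.frestrictLe (π := fun _ : ℕ => A) n) :=
    Preorder.measurable_frestrictLe n
  change (μ.map (Preorder.frestrictLe n)) {a} = (ν.map (Preorder.frestrictLe n)) {a}
  rw [Measure.map_apply hn (measurableSet_singleton a), Measure.map_apply hn
    (measurableSet_singleton a)]
  -- A word of length `n + 1` is extended to a sequence by an arbitrary letter `a₀`.
  rcases isEmpty_or_nonempty A with hA | ⟨⟨a₀⟩⟩
  · have : IsEmpty (ℕ → A) := ⟨fun f => hA.elim (f 0)⟩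
    rw [Measure.eq_zero_of_isEmpty μ, Measure.eq_zero_of_isEmpty ν]
  have hset : (Preorder.frestrictLe (π := fun _ : ℕ => A) n) ⁻¹' {a} =
      {z | ∀ i ≤ n, z i = if hi : i ≤ n then a ⟨i, Finset.mem_Iic.2 hi⟩ else a₀} := by
    ext z
    simp only [Set.mem_preimage, Set.mem_singleton_iff, Set.mem_ofPred_eq]
    constructor
    · rintro rfl i hi
      simp [hi]
    · intro hz
      ext i
      have := hz i (Finset.mem_Iic.1 i.2)
      rw [dif_pos (Finset.mem_Iic.1 i.2)] at this
      exact this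
  rw [hset]
  exact h n _

variable {p q : ℝ} {coin : Measure (ℤ → Fin 2)}

/-- Detailed balance, the source of the backward Markov property. -/
lemma coinStat_mul_coinStep (p q : ℝ) (i j : Fin 2) :
    coinStat p q i * coinStep p q i j = coinStat p q j * coinStep p q j i := by
  fin_cases i <;> fin_cases j <;> simp [coinStat, coinStep] <;> ring

lemma coinStep_nonneg (hp : p ∈ Set.Icc (0 : ℝ) 1) (hq : q ∈ Set.Icc (0 : ℝ) 1) (i j : Fin 2) :
    0 ≤ coinStep p q i j := by
  fin_cases i <;> fin_cases j <;> simp [coinStep, hp.1, hp.2, hq.1, hq.2]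

/-- The Markov property of the coin, run backwards from time `0`. -/
lemma coin_backward [IsProbabilityMeasure coin] (hp : p ∈ Set.Icc (0 : ℝ) 1)
    (hq : q ∈ Set.Icc (0 : ℝ) 1) (hcoin : IsPerturbedCoin p q coin) (i j k : Fin 2)
    {S : Set (ℕ → Fin 2)} (hS : MeasurableSet S) :
    coin {c | (c (-2) = i ∧ c (-1) = j ∧ c 0 = k) ∧ tail c ∈ S} =
      ENNReal.ofReal (coinStep p q k j * coinStep p q j i) * coin {c | c 0 = k ∧ tail c ∈ S} := by
  have hA : MeasurableSet {c : ℤ → Fin 2 | c (-2) = i ∧ c (-1) = j ∧ c 0 = k} :=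
    (measurableSet_coordinate (-2) i).inter
      ((measurableSet_coordinate (-1) j).inter (measurableSet_coordinate 0 k))
  have hB : MeasurableSet {c : ℤ → Fin 2 | c 0 = k} :=
    measurableSet_coordinate 0 k
  have hmeas : (coin.restrict {c : ℤ → Fin 2 | c (-2) = i ∧ c (-1) = j ∧ c 0 = k}).map tail =
      ENNReal.ofReal (coinStep p q k j * coinStep p q j i) •
        (coin.restrict {c : ℤ → Fin 2 | c 0 = k}).map tail := by
    have : IsFiniteMeasure (ENNReal.ofReal (coinStep p q k j * coinStep p q j i) •
        (coin.restrict {c : ℤ → Fin 2 | c 0 = k}).map tail) :=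
      Measure.smul_finite _ ENNReal.ofReal_ne_top
    refine ext_of_initial_cylinders fun n w => ?_
    have hcyl : MeasurableSet {z : ℕ → Fin 2 | ∀ i ≤ n, z i = w i} := by
      have : {z : ℕ → Fin 2 | ∀ i ≤ n, z i = w i} = ⋂ i, ⋂ (_ : i ≤ n), {z | z i = w i} := by
        ext; simp
      rw [this]
      exact MeasurableSet.iInter fun i => MeasurableSet.iInter fun _ =>
        measurableSet_coordinate i _
    rw [Measure.smul_apply, Measure.map_apply measurable_tail hcyl,
      Measure.map_apply measurable_tail hcyl, Measure.restrict_apply (measurable_tail hcyl),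
      Measure.restrict_apply (measurable_tail hcyl), smul_eq_mul]
    by_cases hk : w 0 = k
    · have h1 : tail ⁻¹' {z | ∀ i ≤ n, z i = w i} ∩ {c | c 0 = k} =
          {c | ∀ i ≤ n, c (0 + (i : ℤ)) = w i} := by
        ext c
        simp only [Set.mem_inter_iff, Set.mem_preimage, Set.mem_ofPred_eq, tail, zero_add]
        exact ⟨fun h => h.1, fun h => ⟨h, by simpa [hk] using h 0 (Nat.zero_le _)⟩⟩
      -- The word `w` with `i`, `j` put in front: a cylinder starting at time `-2`.
      let w' : ℕ → Fin 2 := fun m => match m with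
        | 0 => i
        | 1 => j
        | m + 2 => w m
      have h2 : tail ⁻¹' {z | ∀ i ≤ n, z i = w i} ∩ {c | c (-2) = i ∧ c (-1) = j ∧ c 0 = k} =
          {c | ∀ m ≤ n + 2, c (-2 + (m : ℤ)) = w' m} := by
        ext c
        simp only [Set.mem_inter_iff, Set.mem_preimage, Set.mem_ofPred_eq, tail]
        constructor
        · rintro ⟨h, hi, hj, -⟩ m hm
          match m with
          | 0 => simpa [w'] using hi
          | 1 => simpa [w'] using hj
          | m + 2 =>
            have := h m (by omega)
            have e : (-2 + ((m + 2 : ℕ) : ℤ)) = m := by push_cast; ring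
            rw [e, this]
        · intro h
          refine ⟨fun m hm => ?_, by simpa [w'] using h 0 (by omega),
            by simpa [w'] using h 1 (by omega), ?_⟩
          · have := h (m + 2) (by omega)
            have e : (-2 + ((m + 2 : ℕ) : ℤ)) = m := by push_cast; ring
            rwa [e] at this
          · have := h 2 (by omega)
            simpa [w', hk] using this
      rw [h1, h2, hcoin, hcoin, ← ENNReal.ofReal_mul
        (mul_nonneg (coinStep_nonneg hp hq _ _) (coinStep_nonneg hp hq _ _))]
      congr 1
      -- Splits off the first two transitions; detailed balance, applied twice, turns `π_i P_ij
      -- P_jk` into `π_k P_kj P_ji`.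
      rw [Finset.prod_range_succ', Finset.prod_range_succ']
      simp only [w', hk]
      have e1 := coinStat_mul_coinStep p q i j
      have e2 := coinStat_mul_coinStep p q j k
      linear_combination (∏ m ∈ Finset.range n, coinStep p q (w m) (w (m + 1))) *
        (coinStep p q j k * e1 + coinStep p q j i * e2)
    · have h1 : tail ⁻¹' {z | ∀ i ≤ n, z i = w i} ∩ {c | c 0 = k} = ∅ := by
        ext c
        simp only [Set.mem_inter_iff, Set.mem_preimage, Set.mem_ofPred_eq, tail,
          Set.mem_empty_iff_false, iff_false, not_and]
        intro h h0
        exact hk ((h 0 (Nat.zero_le _)).symm.trans h0)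
      have h2 : tail ⁻¹' {z | ∀ i ≤ n, z i = w i} ∩ {c | c (-2) = i ∧ c (-1) = j ∧ c 0 = k} =
          ∅ :=
        Set.subset_empty_iff.1 (h1 ▸ Set.inter_subset_inter_right _ fun c hc => hc.2.2)
      rw [h1, h2, measure_empty, mul_zero]
  have h := congrArg (fun m => m S) hmeas
  simp only [Measure.smul_apply, smul_eq_mul] at h
  rw [Measure.map_apply measurable_tail hS, Measure.map_apply measurable_tail hS,
    Measure.restrict_apply (measurable_tail hS), Measure.restrict_apply (measurable_tail hS)] at h
  rw [Set.inter_comm, Set.inter_comm _ {c : ℤ → Fin 2 | c 0 = k}] at h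
  exact h

/-- The next reversed symbol is `x₋₁`, fixed by `c₋₂, c₋₁`, and the last one is `x₀`, fixed by `c₋₁,
c₀`. Both sides of the conditional expectation identity are thus functions `g` of this triple, and
their integrals become finite sums. -/
lemma setIntegral_past [IsProbabilityMeasure coin] (hp : p ∈ Set.Icc (0 : ℝ) 1)
    (hq : q ∈ Set.Icc (0 : ℝ) 1) (hcoin : IsPerturbedCoin p q coin)
    (g : Fin 2 × Fin 2 × Fin 2 → ℝ) {S : Set (ℕ → Fin 3)} (hS : MeasurableSet S) :
    ∫ c in {c | past (timeReverse (herald c)) ∈ S}, g (c (-2), c (-1), c 0) ∂coin =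
      ∑ t : Fin 2 × Fin 2 × Fin 2, coinStep p q t.2.2 t.2.1 * coinStep p q t.2.1 t.1 *
        coin.real {c | c 0 = t.2.2 ∧ heraldTail t.2.1 (tail c) ∈ S} * g t := by
  have ht : Measurable fun c : ℤ → Fin 2 => (c (-2), c (-1), c 0) :=
    (measurable_pi_apply _).prodMk ((measurable_pi_apply _).prodMk (measurable_pi_apply _))
  have hm : MeasurableSet {c | past (timeReverse (herald c)) ∈ S} :=
    (measurable_past.comp measurable_timeReverse_herald) hS
  rw [← integral_map (f := g) (φ := fun c : ℤ → Fin 2 => (c (-2), c (-1), c 0)) ht.aemeasurable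
    AEStronglyMeasurable.of_discrete, integral_fintype Integrable.of_finite]
  refine Finset.sum_congr rfl fun t _ => ?_
  obtain ⟨i, j, k⟩ := t
  rw [map_measureReal_apply ht (measurableSet_singleton _),
    measureReal_restrict_apply (ht (measurableSet_singleton _)), smul_eq_mul]
  congr 1
  have hset : (fun c : ℤ → Fin 2 => (c (-2), c (-1), c 0)) ⁻¹' {(i, j, k)} ∩
      {c | past (timeReverse (herald c)) ∈ S} =
      {c | (c (-2) = i ∧ c (-1) = j ∧ c 0 = k) ∧ tail c ∈ heraldTail j ⁻¹' S} := by
    ext c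
    simp only [Set.mem_inter_iff, Set.mem_preimage, Set.mem_singleton_iff, Prod.mk.injEq,
      Set.mem_ofPred_eq, past_timeReverse_herald]
    constructor
    · rintro ⟨⟨hi, hj, hk⟩, h⟩
      exact ⟨⟨hi, hj, hk⟩, hj ▸ h⟩
    · rintro ⟨⟨hi, hj, hk⟩, h⟩
      exact ⟨⟨hi, hj, hk⟩, hj.symm ▸ h⟩
  rw [hset, Measure.real, coin_backward hp hq hcoin i j k (measurable_heraldTail j hS),
    ENNReal.toReal_mul, ENNReal.toReal_ofReal
      (mul_nonneg (coinStep_nonneg hp hq _ _) (coinStep_nonneg hp hq _ _))]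
  rfl

/-- A head symbol `1` hides `c₋₁`; this is where the reversed past leaves the coin undetermined. -/
lemma heraldTail_congr {z : ℕ → Fin 2} (hz : z 0 = 1) : heraldTail 0 z = heraldTail 1 z := by
  ext1 n
  cases n with
  | zero => simp [heraldTail, heraldPair, hz]
  | succ n => rfl

/-- The time-reversed heralding coin is a Markov chain with transition matrix `reverseStep`. -/
theorem nextProb_reversedHeraldingLaw [IsProbabilityMeasure coin] (hp : p ∈ Set.Icc (0 : ℝ) 1)
    (hq : q ∈ Set.Icc (0 : ℝ) 1) (hcoin : IsPerturbedCoin p q coin) (a : Fin 3) :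
    nextProb (reversedHeraldingLaw coin) a =ᵐ[reversedHeraldingLaw coin]
      fun y => reverseStep p q (past y 0) a := by
  have hE : MeasurableSet {x : ℤ → Fin 3 | x 0 = a} :=
    measurableSet_coordinate 0 a
  have hg : Measurable fun y : ℤ → Fin 3 => reverseStep p q (past y 0) a :=
    (Measurable.of_discrete (f := fun j => reverseStep p q j a)).comp
      ((measurable_pi_apply 0).comp measurable_past)
  have hgint : Integrable (fun y : ℤ → Fin 3 => reverseStep p q (past y 0) a)
      (reversedHeraldingLaw coin) := by
    have : Integrable (fun j => reverseStep p q j a)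
        ((reversedHeraldingLaw coin).map fun y => past y 0) := by
      have : IsFiniteMeasure ((reversedHeraldingLaw coin).map fun y => past y 0) :=
        inferInstance
      exact Integrable.of_finite
    exact this.comp_measurable ((measurable_pi_apply 0).comp measurable_past)
  refine (ae_eq_condExp_of_forall_setIntegral_eq measurable_past.comap_le
    ((integrable_const (1 : ℝ)).indicator hE) (fun s _ _ => hgint.integrableOn) ?_ ?_).symm
  · rintro s ⟨S, hS, rfl⟩ -
    have hm : MeasurableSet (past ⁻¹' S : Set (ℤ → Fin 3)) := measurable_past hS
    rw [reversedHeraldingLaw_eq, setIntegral_map hm hg.aestronglyMeasurable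
        measurable_timeReverse_herald.aemeasurable,
      setIntegral_map hm ((measurable_const.indicator hE).aestronglyMeasurable)
        measurable_timeReverse_herald.aemeasurable]
    have h1 := setIntegral_past hp hq hcoin
      (fun t => reverseStep p q (heraldPair t.2.1 t.2.2) a) hS
    have h2 := setIntegral_past hp hq hcoin
      (fun t => if heraldPair t.1 t.2.1 = a then 1 else 0) hS
    have e1 : ∀ c : ℤ → Fin 2, reverseStep p q (past (timeReverse (herald c)) 0) a =
        reverseStep p q (heraldPair (c (-1)) (c 0)) a := by
      intro c
      rw [past_timeReverse_herald]
      rfl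
    have e2 : ∀ c : ℤ → Fin 2, {x : ℤ → Fin 3 | x 0 = a}.indicator (fun _ => (1 : ℝ))
        (timeReverse (herald c)) = if heraldPair (c (-2)) (c (-1)) = a then 1 else 0 := by
      intro c
      have h : timeReverse (herald c) 0 = heraldPair (c (-2)) (c (-1)) := rfl
      simp [Set.indicator_apply, h]
    simp only [e1, e2]
    refine h1.trans (Eq.trans ?_ h2.symm)
    have hM : coin.real {c | c 0 = 1 ∧ heraldTail 0 (tail c) ∈ S} =
        coin.real {c | c 0 = 1 ∧ heraldTail 1 (tail c) ∈ S} := by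
      congr 1
      ext c
      exact and_congr_right fun h => by rw [heraldTail_congr h]
    -- After `hM` three unknown weights remain, one for each last symbol, and their coefficients on
    -- the two sides agree.
    simp only [Fintype.sum_prod_type, Fin.sum_univ_two, hM]
    fin_cases a <;> simp [reverseStep, heraldPair, coinStep] <;> ring
  · have : Measurable[MeasurableSpace.comap past MeasurableSpace.pi]
        fun y : ℤ → Fin 3 => reverseStep p q (past y 0) a :=
      ((Measurable.of_discrete (f := fun j => reverseStep p q j a)).comp
        (measurable_pi_apply 0)).comp (comap_measurable past)
    exact this.stronglyMeasurable.aestronglyMeasurable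

lemma reversedHeraldingLaw_real [IsProbabilityMeasure coin] (hcoin : IsPerturbedCoin p q coin)
    (hp : p ∈ Set.Icc (0 : ℝ) 1) (hq : q ∈ Set.Icc (0 : ℝ) 1) (j : Fin 3) :
    (reversedHeraldingLaw coin).real {y | past y 0 = j} = retroWeight p q j := by
  have hstat : ∀ i, 0 ≤ coinStat p q i := by
    have := hp.1
    have := hq.1
    intro i
    fin_cases i <;> simp [coinStat] <;> positivity
  have hpair : ∀ a b : Fin 2, coin.real {c | c (-1) = a ∧ c 0 = b} =
      coinStat p q a * coinStep p q a b := by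
    intro a b
    have h := hcoin (-1) 1 fun m => if m = 0 then a else b
    have hset : {c : ℤ → Fin 2 | ∀ i ≤ (1 : ℕ), c (-1 + (i : ℤ)) = if i = 0 then a else b} =
        {c | c (-1) = a ∧ c 0 = b} := by
      ext c
      simp only [Set.mem_ofPred_eq]
      constructor
      · intro h
        exact ⟨by simpa using h 0 (by omega), by simpa using h 1 le_rfl⟩
      · rintro ⟨h0, h1⟩ i hi
        rcases Nat.le_one_iff_eq_zero_or_eq_one.1 hi with rfl | rfl
        · simpa using h0
        · simpa using h1
    rw [hset] at h
    rw [Measure.real, h]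
    simp [ENNReal.toReal_ofReal, hstat, coinStep_nonneg hp hq]
  have hone : coin.real {c | c 0 = 1} = coinStat p q 1 := by
    have h := hcoin 0 0 fun _ => 1
    simp only [Nat.le_zero_eq, forall_eq, Nat.cast_zero, add_zero, Finset.range_zero,
      Finset.prod_empty, mul_one] at h
    rw [Measure.real, h, ENNReal.toReal_ofReal (hstat _)]
  have hm : MeasurableSet {y : ℤ → Fin 3 | past y 0 = j} :=
    ((measurable_pi_apply 0).comp measurable_past) (measurableSet_singleton j)
  rw [reversedHeraldingLaw_eq, map_measureReal_apply measurable_timeReverse_herald hm]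
  have hset : (fun c : ℤ → Fin 2 => timeReverse (herald c)) ⁻¹' {y | past y 0 = j} =
      {c | heraldPair (c (-1)) (c 0) = j} := by
    ext c
    simp only [Set.mem_preimage, Set.mem_ofPred_eq, past_timeReverse_herald]
    rfl
  rw [hset]
  have hF : ∀ x : Fin 2, x = 0 ∨ x = 1 := by decide
  fin_cases j
  · have : {c : ℤ → Fin 2 | heraldPair (c (-1)) (c 0) = (0 : Fin 3)} =
        {c | c (-1) = 0 ∧ c 0 = 0} := by
      ext c
      rcases hF (c (-1)) with h | h <;> rcases hF (c 0) with h' | h' <;>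
        simp [heraldPair, h, h']
    change coin.real {c : ℤ → Fin 2 | heraldPair (c (-1)) (c 0) = (0 : Fin 3)} = _
    rw [this, hpair]
    simp [coinStat, coinStep, retroWeight]
    ring
  · have : {c : ℤ → Fin 2 | heraldPair (c (-1)) (c 0) = (1 : Fin 3)} = {c | c 0 = 1} := by
      ext c
      rcases hF (c (-1)) with h | h <;> rcases hF (c 0) with h' | h' <;>
        simp [heraldPair, h, h']
    change coin.real {c : ℤ → Fin 2 | heraldPair (c (-1)) (c 0) = (1 : Fin 3)} = _
    rw [this, hone]
    simp [coinStat, retroWeight]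
  · have : {c : ℤ → Fin 2 | heraldPair (c (-1)) (c 0) = (2 : Fin 3)} =
        {c | c (-1) = 1 ∧ c 0 = 0} := by
      ext c
      rcases hF (c (-1)) with h | h <;> rcases hF (c 0) with h' | h' <;>
        simp [heraldPair, h, h']
    change coin.real {c : ℤ → Fin 2 | heraldPair (c (-1)) (c 0) = (2 : Fin 3)} = _
    rw [this, hpair]
    simp [coinStat, coinStep, retroWeight]
    ring

end Coin

/-! ### Overlap bounds from output statistics -/

section Fidelity

variable {H : Type*} [NormedAddCommGroup H] [InnerProductSpace ℂ H] {ι κ : Type*}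

/-- Polarization of the completeness relation. -/
lemma hasSum_inner_of_hasSum_norm_sq {K : ι → H →L[ℂ] H}
    (hK : ∀ v, HasSum (fun i => ‖K i v‖ ^ 2) (‖v‖ ^ 2)) (x y : H) :
    HasSum (fun i => inner ℂ (K i x) (K i y)) (inner ℂ x y) := by
  have h : ∀ v, HasSum (fun i => ((‖K i v‖ : ℝ) : ℂ) ^ 2) (((‖v‖ : ℝ) : ℂ) ^ 2) := fun v => by
    have := Complex.hasSum_ofReal.2 (hK v)
    simpa using this
  simp only [inner_eq_sum_norm_sq_div_four, ← map_add, ← map_sub, ← map_smul]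
  exact (((h _).sub (h _)).add (((h _).sub (h _)).mul_right _)).div_const 4

/-- The overlap of two states is at most the Bhattacharyya overlap of their outcome
distributions. -/
lemma norm_inner_le_sum_sqrt [Fintype ι] {K : ι → κ → H →L[ℂ] H}
    (hK : ∀ v : H, HasSum (fun i : ι × κ => ‖K i.1 i.2 v‖ ^ 2) (‖v‖ ^ 2)) {x y : H} {s t : ι → ℝ}
    (hs : ∀ a, HasSum (fun k => ‖K a k x‖ ^ 2) (s a))
    (ht : ∀ a, HasSum (fun k => ‖K a k y‖ ^ 2) (t a)) :
    ‖inner ℂ x y‖ ≤ ∑ a, √(s a) * √(t a) := by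
  classical
  have h := hasSum_inner_of_hasSum_norm_sq (K := fun i : ι × κ => K i.1 i.2) hK x y
  -- Each finite partial sum is enlarged to a full product over outcomes, so that Cauchy–Schwarz
  -- applies in `k` for each fixed outcome.
  refine le_of_tendsto (h.norm) (Filter.Eventually.of_forall fun A => ?_)
  calc _ ≤ ∑ i ∈ A, ‖K i.1 i.2 x‖ * ‖K i.1 i.2 y‖ :=
        norm_sum_le_of_le _ fun i _ => norm_inner_le_norm _ _
    _ ≤ ∑ i ∈ Finset.univ ×ˢ A.image Prod.snd, ‖K i.1 i.2 x‖ * ‖K i.1 i.2 y‖ := by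
        refine Finset.sum_le_sum_of_subset_of_nonneg (fun i hi => ?_) fun i _ _ => by positivity
        exact Finset.mem_product.2 ⟨Finset.mem_univ _, Finset.mem_image_of_mem _ hi⟩
    _ = ∑ a, ∑ k ∈ A.image Prod.snd, ‖K a k x‖ * ‖K a k y‖ := Finset.sum_product _ _ _
    _ ≤ _ := by
        refine Finset.sum_le_sum fun a _ => (Real.sum_mul_le_sqrt_mul_sqrt _ _ _).trans ?_
        gcongr
        · exact sum_le_hasSum _ (fun k _ => by positivity) (hs a)
        · exact sum_le_hasSum _ (fun k _ => by positivity) (ht a)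

lemma ketBra_smul (c : ℂ) (v : H) : ketBra (c • v) = ((‖c‖ ^ 2 : ℝ) : ℂ) • ketBra v := by
  ext x
  simp only [ketBra_apply, inner_smul_left, smul_smul, smul_apply]
  rw [mul_right_comm, Complex.conj_mul', Complex.ofReal_pow]

lemma reverseStep_nonneg {p q : ℝ} (hp : p ∈ Set.Icc (0 : ℝ) 1) (hq : q ∈ Set.Icc (0 : ℝ) 1)
    (j a : Fin 3) : 0 ≤ reverseStep p q j a := by
  have hp1' : 0 ≤ 1 - p := by linarith [hp.2]
  have hq1' : 0 ≤ 1 - q := by linarith [hq.2]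
  fin_cases j <;> fin_cases a <;>
    simp [reverseStep, hp.1, hq.1, hq.2, mul_nonneg, hp1']

/-- Row `1` restricted to the outputs `0, 2` is `q` times row `0`, and row `2` is concentrated on
the output `1`; hence `p` drops out. The bound of `norm_inner_le_sum_sqrt` is thereby attained by
`Q⁻` for all pairs at once. -/
lemma sum_sqrt_reverseStep {p q : ℝ} (hp : p ∈ Set.Icc (0 : ℝ) 1) (hq : q ∈ Set.Icc (0 : ℝ) 1)
    (j k : Fin 3) : ∑ a, √(reverseStep p q j a) * √(reverseStep p q k a) =
      ‖inner ℂ (retroState q j) (retroState q k)‖ := by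
  obtain ⟨hp0, hp1⟩ := hp
  have hp1' : 0 ≤ 1 - p := by linarith
  have hq1' : 0 ≤ 1 - q := by linarith [hq.2]
  have e1 := Real.mul_self_sqrt hp0
  have e2 := Real.mul_self_sqrt hp1'
  have e3 := Real.mul_self_sqrt hq.1
  have e4 := Real.mul_self_sqrt hq1'
  have hself : ∀ j, ‖inner ℂ (retroState q j) (retroState q j)‖ = 1 := fun j => by
    rw [inner_self_eq_norm_sq_to_K, norm_retroState hq]; simp
  rcases eq_or_ne j k with rfl | hjk
  · rw [hself]
    fin_cases j <;> simp [reverseStep, Fin.sum_univ_three, Real.sqrt_mul hq.1, e1, e2, e4]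
    linear_combination q * e1 + q * e2 + (√p * √p + √(1 - p) * √(1 - p)) * e3
  · fin_cases j <;> fin_cases k <;> first | exact absurd rfl hjk | skip
    all_goals
      simp [reverseStep, Fin.sum_univ_three, Real.sqrt_mul hq.1, retroState, PiLp.inner_apply,
        Fin.sum_univ_two, abs_of_nonneg, Real.sqrt_nonneg]
    all_goals linear_combination √q * e1 + √q * e2

end Fidelity

/-! ### Evaluating the circuit -/

section Circuit

/-- A controlled gate changes only its target qubit, so the sum over eight basis states reduces to
two terms. -/
lemma mul_controlled_apply (M : Matrix (Fin 3 → Fin 2) (Fin 3 → Fin 2) ℂ) (c t : Fin 3)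
    (w : Fin 2) (U : Matrix (Fin 2) (Fin 2) ℂ) (x y : Fin 3 → Fin 2) :
    (M * controlled c t w U) x y = ∑ b, M x (Function.update y t b) *
      if y c = w then U b (y t) else if b = y t then 1 else 0 := by
  rw [Matrix.mul_apply]
  have hinj : Function.Injective (Function.update y t) := Function.update_injective y t
  rw [← Finset.sum_subset (Finset.subset_univ (Finset.univ.image (Function.update y t))),
    Finset.sum_image hinj.injOn]
  · refine Finset.sum_congr rfl fun b _ => ?_
    congr 1
    have h : ∀ j, j ≠ t → Function.update y t b j = y j := fun j hj =>
      Function.update_of_ne hj _ _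
    simp only [controlled, Matrix.of_apply, if_pos h, Function.update_self]
  · intro z _ hz
    have h : ¬ ∀ j, j ≠ t → z j = y j := by
      intro h
      refine hz (Finset.mem_image.2 ⟨z t, Finset.mem_univ _, ?_⟩)
      ext1 j
      by_cases hj : j = t
      · subst hj; simp
      · rw [Function.update_of_ne hj, h j hj]
    simp only [controlled, Matrix.of_apply, if_neg h, mul_zero]

/-- The Kraus operators of the retrocausal model as explicit matrices. -/
def retroKrausMatrix (p q : ℝ) : Fin 3 → Matrix (Fin 2) (Fin 2) ℂ :=
  ![!![(√(1 - p) : ℂ), 0; 0, 0], !![0, (√q : ℂ); 0, (√(1 - q) : ℂ)], !![0, 0; (√p : ℂ), 0]]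

lemma retroKraus_eq (p q : ℝ) (a : Fin 3) (u : Unit) :
    retroKraus p q a u = Matrix.toEuclideanCLM (n := Fin 2) (𝕜 := ℂ) (retroKrausMatrix p q a) := by
  rw [retroKraus]
  congr 1
  ext c w
  have u1 : ∀ b : Fin 2, Function.update ![w, 0, 0] 1 b = ![w, b, 0] := fun b => by
    ext j; fin_cases j <;> rfl
  have u2 : ∀ b b' : Fin 2, Function.update ![w, b, 0] 2 b' = ![w, b, b'] := fun b b' => by
    ext j; fin_cases j <;> rfl
  simp only [Matrix.of_apply, retroCircuit, mul_controlled_apply, u1, u2]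
  fin_cases a <;> fin_cases c <;> fin_cases w <;>
    simp [controlled, outcomeCode, gateP, gateQ, retroKrausMatrix, Fin.forall_fin_succ]

/-- Contains both model conditions: the squared amplitude is the output probability, and the
resulting state is that of the new last symbol. -/
lemma retroKraus_retroState {p q : ℝ} (hp : p ∈ Set.Icc (0 : ℝ) 1) (hq : q ∈ Set.Icc (0 : ℝ) 1)
    (a j : Fin 3) (u : Unit) : retroKraus p q a u (retroState q j) =
      ((√(reverseStep p q j a) : ℝ) : ℂ) • retroState q a := by
  rw [retroKraus_eq]
  ext i
  change (retroKrausMatrix p q a).mulVec (retroState q j) i = _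
  fin_cases a <;> fin_cases j <;> fin_cases i <;>
    simp [retroKrausMatrix, retroState, reverseStep, Real.sqrt_mul hq.1, Real.sqrt_mul hp.1, Matrix.mulVec,
      dotProduct, Fin.sum_univ_two, mul_comm]

lemma sum_norm_sq_retroKraus {p q : ℝ} (hp : p ∈ Set.Icc (0 : ℝ) 1)
    (hq : q ∈ Set.Icc (0 : ℝ) 1) (v : EuclideanSpace ℂ (Fin 2)) :
    ∑ a, ‖retroKraus p q a () v‖ ^ 2 = ‖v‖ ^ 2 := by
  have hp1' : 0 ≤ 1 - p := by linarith [hp.2]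
  have hq1' : 0 ≤ 1 - q := by linarith [hq.2]
  have h : ∀ a i, (retroKraus p q a () v) i = (retroKrausMatrix p q a).mulVec v i := fun a i => by
    rw [retroKraus_eq]; rfl
  simp only [EuclideanSpace.norm_sq_eq, h]
  simp [Fin.sum_univ_three, Fin.sum_univ_two, retroKrausMatrix, Matrix.mulVec, dotProduct,
    mul_pow, Real.sq_sqrt, hp.1, hq.1, hp1', hq1']
  ring

end Circuit

/-! ### Optimality and overlap constraints -/

section Model

variable {p q : ℝ} {coin : Measure (ℤ → Fin 2)} [IsProbabilityMeasure coin]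

/-- The retrocausal encoding and circuit form a quantum model. -/
theorem isQuantumModel_retro (hp : p ∈ Set.Icc (0 : ℝ) 1) (hq : q ∈ Set.Icc (0 : ℝ) 1)
    (hcoin : IsPerturbedCoin p q coin) :
    IsQuantumModel (reversedHeraldingLaw coin) (retroEncode q) (retroKraus p q) where
  norm_encode x := norm_retroState hq _
  measurable_encode :=
    ((Measurable.of_discrete (f := retroState q)).comp
      (measurable_pi_apply 0)).stronglyMeasurable.aestronglyMeasurable
  kraus_complete v := by
    rw [← sum_norm_sq_retroKraus hp hq v]
    have h := hasSum_fintype fun i : Fin 3 × Unit => ‖retroKraus p q i.1 i.2 v‖ ^ 2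
    simp only [Fintype.sum_prod_type, Fintype.sum_unique] at h
    exact h
  output a := by
    filter_upwards [nextProb_reversedHeraldingLaw hp hq hcoin a] with x hx
    rw [hx]
    have h := hasSum_fintype fun k : Unit => ‖retroKraus p q a k (retroEncode q (past x))‖ ^ 2
    convert h using 1
    rw [Fintype.sum_unique, retroEncode, retroKraus_retroState hp hq, norm_smul,
      norm_retroState hq, mul_one, Complex.norm_real, Real.norm_of_nonneg (Real.sqrt_nonneg _),
      Real.sq_sqrt (reverseStep_nonneg hp hq _ _)]
  update a := by
    filter_upwards [nextProb_reversedHeraldingLaw hp hq hcoin a] with x hx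
    rw [hx]
    have h := hasSum_fintype fun k : Unit => ketBra (retroKraus p q a k (retroEncode q (past x)))
    convert h using 1
    rw [Fintype.sum_unique, retroEncode, retroEncode, retroKraus_retroState hp hq, ketBra_smul,
      Complex.norm_real, Real.norm_of_nonneg (Real.sqrt_nonneg _),
      Real.sq_sqrt (reverseStep_nonneg hp hq _ _)]
    rfl

/-- Almost surely, the outcome distribution of a quantum model of the reversed heralding coin is
given by the transition matrix. -/
lemma ae_hasSum_reverseStep (hp : p ∈ Set.Icc (0 : ℝ) 1) (hq : q ∈ Set.Icc (0 : ℝ) 1)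
    (hcoin : IsPerturbedCoin p q coin) {H : Type u} [NormedAddCommGroup H]
    [InnerProductSpace ℂ H] [CompleteSpace H] {κ : Type v} {f : (ℕ → Fin 3) → H}
    {K : Fin 3 → κ → H →L[ℂ] H} (h : IsQuantumModel (reversedHeraldingLaw coin) f K) :
    ∀ᵐ x ∂(reversedHeraldingLaw coin), ∀ a,
      HasSum (fun k => ‖K a k (f (past x))‖ ^ 2) (reverseStep p q (past x 0) a) := by
  rw [ae_all_iff]
  intro a
  filter_upwards [h.output a, nextProb_reversedHeraldingLaw hp hq hcoin a] with x h1 h2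
  rwa [← h2]

lemma retroWeight_eq (hp : p ∈ Set.Icc (0 : ℝ) 1) (hq : q ∈ Set.Icc (0 : ℝ) 1)
    (hcoin : IsPerturbedCoin p q coin) : retroWeight p q =
      fun j => (reversedHeraldingLaw coin).real ((fun y => past y 0) ⁻¹' {j}) :=
  funext fun j => (reversedHeraldingLaw_real hcoin hp hq j).symm

lemma measurable_past_zero : Measurable fun y : ℤ → Fin 3 => past y 0 :=
  (measurable_pi_apply 0).comp measurable_past

lemma memoryState_eq {H : Type u} [NormedAddCommGroup H] [InnerProductSpace ℂ H]
    [CompleteSpace H] {f : (ℕ → Fin 3) → H} {P : Measure (ℤ → Fin 3)}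
    (hf : AEStronglyMeasurable f (P.map past)) :
    memoryState P f = ∫ y, ketBra (f (past y)) ∂P :=
  integral_map (f := fun x => ketBra (f x)) measurable_past.aemeasurable
    (continuous_ketBra.comp_aestronglyMeasurable hf)

lemma memoryState_retroEncode (hp : p ∈ Set.Icc (0 : ℝ) 1) (hq : q ∈ Set.Icc (0 : ℝ) 1)
    (hcoin : IsPerturbedCoin p q coin) :
    memoryState (reversedHeraldingLaw coin) (retroEncode q) =
      mixture (retroWeight p q) (retroState q) := by
  rw [memoryState_eq (isQuantumModel_retro hp hq hcoin).measurable_encode,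
    retroWeight_eq hp hq hcoin]
  exact integral_ketBra_comp measurable_past_zero (retroState q)

/-- The retrocausal model has minimal entropy. -/
theorem isOptimalQuantumModel_retro (hp : p ∈ Set.Icc (0 : ℝ) 1) (hq : q ∈ Set.Icc (0 : ℝ) 1)
    (hcoin : IsPerturbedCoin p q coin) :
    IsOptimalQuantumModel.{u, v} (reversedHeraldingLaw coin) (retroEncode q) (retroKraus p q) := by
  refine ⟨isQuantumModel_retro hp hq hcoin, fun H' _ _ _ κ' f' K' h => ?_⟩
  rw [modelEntropy, modelEntropy, memoryState_retroEncode hp hq hcoin,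
    memoryState_eq h.measurable_encode]
  refine (retro_majorizes_and_entropy_le hq (h.measurable_encode.comp_measurable measurable_past)
    (fun x => h.norm_encode _) measurable_past_zero (retroWeight_eq hp hq hcoin) ?_).2
  have hgood := ae_hasSum_reverseStep hp hq hcoin h
  filter_upwards [hgood] with x hx
  filter_upwards [hgood] with x' hx'
  rw [← sum_sqrt_reverseStep hp hq]
  exact norm_inner_le_sum_sqrt h.kraus_complete hx hx'

/-- The overlaps of a model with one internal state per causal state. -/
lemma norm_inner_le_of_isQuantumModel (hp0 : 0 < p) (hp1 : p < 1) (hq0 : 0 < q) (hq1 : q ≤ 1)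
    (hcoin : IsPerturbedCoin p q coin) {H : Type u} [NormedAddCommGroup H]
    [InnerProductSpace ℂ H] [CompleteSpace H] {κ : Type v} {ψ : Fin 3 → H}
    {K : Fin 3 → κ → H →L[ℂ] H}
    (h : IsQuantumModel (reversedHeraldingLaw coin) (fun y => ψ (y 0)) K) (j k : Fin 3) :
    ‖inner ℂ (ψ j) (ψ k)‖ ≤ ‖inner ℂ (retroState q j) (retroState q k)‖ := by
  have hp : p ∈ Set.Icc (0 : ℝ) 1 := ⟨hp0.le, hp1.le⟩
  have hq : q ∈ Set.Icc (0 : ℝ) 1 := ⟨hq0.le, hq1⟩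
  have hpos : ∀ j, 0 < retroWeight p q j := by
    have h1 : 0 < q - p * q := by nlinarith
    intro j
    fin_cases j <;> simp [retroWeight] <;> positivity
  have hex : ∀ j, ∀ a, HasSum (fun k => ‖K a k (ψ j)‖ ^ 2) (reverseStep p q j a) := by
    intro j
    -- The model conditions hold only almost surely; positive probability of the class provides a
    -- past in it where they hold.
    have hfreq : ∃ᵐ y ∂(reversedHeraldingLaw coin), past y 0 = j := by
      rw [frequently_ae_iff]
      intro h0
      have := reversedHeraldingLaw_real hcoin hp hq j
      rw [Measure.real, h0, ENNReal.toReal_zero] at this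
      exact (hpos j).ne this
    obtain ⟨y, rfl, hy⟩ := (hfreq.and_eventually (ae_hasSum_reverseStep hp hq hcoin h)).exists
    exact hy
  rw [← sum_sqrt_reverseStep hp hq]
  exact norm_inner_le_sum_sqrt h.kraus_complete (hex j) (hex k)

end Model

/-! ### Generic form of three internal states -/

section NormalForm

lemma exists_polar_angle (z : ℂ) :
    ∃ t ∈ Set.Icc (0 : ℝ) (2 * Real.pi), z = ((‖z‖ : ℝ) : ℂ) * Complex.exp (t * Complex.I) := by
  have h := (Complex.norm_mul_exp_arg_mul_I z).symm
  by_cases h0 : 0 ≤ z.arg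
  · exact ⟨z.arg, ⟨h0, by linarith [Complex.arg_le_pi z, Real.pi_pos]⟩, h⟩
  · refine ⟨z.arg + 2 * Real.pi, ⟨by linarith [Complex.neg_pi_lt_arg z, Real.pi_pos],
      by linarith⟩, ?_⟩
    push_cast
    rw [add_mul, Complex.exp_add, Complex.exp_two_pi_mul_I, mul_one]
    exact h

/-- A linear map preserving the Gram matrix of a family is isometric on its span. -/
def isometryOfGram {E F : Type*} [NormedAddCommGroup E] [InnerProductSpace ℂ E]
    [NormedAddCommGroup F] [InnerProductSpace ℂ F] {ι : Type*} (ψ : ι → E) (L : E →ₗ[ℂ] F)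
    (hL : ∀ j k, inner ℂ (L (ψ j)) (L (ψ k)) = inner ℂ (ψ j) (ψ k)) :
    Submodule.span ℂ (Set.range ψ) →ₗᵢ[ℂ] F where
  toLinearMap := L.domRestrict _
  norm_map' v := by
    have key : ∀ x ∈ Submodule.span ℂ (Set.range ψ), ∀ y ∈ Submodule.span ℂ (Set.range ψ),
        inner ℂ (L x) (L y) = inner ℂ x y := by
      intro x hx y hy
      induction hx, hy using Submodule.span_induction₂ with
      | mem_mem x y hx hy =>
        obtain ⟨j, rfl⟩ := hx
        obtain ⟨k, rfl⟩ := hy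
        exact hL j k
      | zero_left y hy => simp
      | zero_right x hx => simp
      | add_left x y z _ _ _ h1 h2 => rw [map_add, inner_add_left, inner_add_left, h1, h2]
      | add_right x y z _ _ _ h1 h2 => rw [map_add, inner_add_right, inner_add_right, h1, h2]
      | smul_left r x y _ _ h => rw [map_smul, inner_smul_left, inner_smul_left, h]
      | smul_right r x y _ _ h => rw [map_smul, inner_smul_right, inner_smul_right, h]
    have h := congrArg Complex.re (key v v.2 v v.2)
    have h2 : ‖L v‖ ^ 2 = ‖(v : E)‖ ^ 2 := by
      rw [← inner_self_eq_norm_sq (𝕜 := ℂ), ← inner_self_eq_norm_sq (𝕜 := ℂ)]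
      exact h
    exact (sq_eq_sq₀ (norm_nonneg _) (norm_nonneg _)).1 h2

/-- Three unit vectors, the first and the last orthogonal, in generic form. -/
theorem exists_isometry_genericState {H : Type*} [NormedAddCommGroup H] [InnerProductSpace ℂ H]
    {ψ : Fin 3 → H} (hψ : ∀ j, ‖ψ j‖ = 1) (h02 : inner ℂ (ψ 0) (ψ 2) = 0) {s t : ℝ}
    (hs : ‖inner ℂ (ψ 0) (ψ 1)‖ ≤ s) (ht : ‖inner ℂ (ψ 2) (ψ 1)‖ ≤ t) :
    ∃ r θ α ω : ℝ, r ∈ Set.Icc (0 : ℝ) 1 ∧ θ ∈ Set.Icc (0 : ℝ) (Real.pi / 2) ∧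
      α ∈ Set.Icc (0 : ℝ) (2 * Real.pi) ∧ ω ∈ Set.Icc (0 : ℝ) (2 * Real.pi) ∧
      r * Real.sin θ ≤ s ∧ √(1 - r ^ 2) ≤ t ∧
      ∃ U : Submodule.span ℂ (Set.range ψ) →ₗᵢ[ℂ] EuclideanSpace ℂ (Fin 3),
        ∀ j, U ⟨ψ j, Submodule.subset_span ⟨j, rfl⟩⟩ = genericState r θ α ω j := by
  have hself : ∀ j, inner ℂ (ψ j) (ψ j) = 1 := fun j => by
    rw [inner_self_eq_norm_sq_to_K, hψ]; simp
  have h20 : inner ℂ (ψ 2) (ψ 0) = 0 := by rw [← inner_conj_symm, h02, map_zero]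
  set a := inner ℂ (ψ 0) (ψ 1) with ha
  set b := inner ℂ (ψ 2) (ψ 1) with hb
  have ha' : inner ℂ (ψ 1) (ψ 0) = (starRingEnd ℂ) a := (inner_conj_symm _ _).symm
  have hb' : inner ℂ (ψ 1) (ψ 2) = (starRingEnd ℂ) b := (inner_conj_symm _ _).symm
  -- The part of `ψ 1` orthogonal to `ψ 0` and `ψ 2`. Normalizing it gives the third basis vector,
  -- whose coefficient is then real and nonnegative.
  set χ := ψ 1 - a • ψ 0 - b • ψ 2 with hχ
  have hχ0 : inner ℂ χ (ψ 0) = 0 := by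
    simp [hχ, ha', hψ, h20]
  have hχ2 : inner ℂ χ (ψ 2) = 0 := by
    simp [hχ, hb', hψ, h02]
  have hχ1 : inner ℂ χ (ψ 1) = ((‖χ‖ ^ 2 : ℝ) : ℂ) := by
    have : inner ℂ χ χ = inner ℂ χ (ψ 1) := by
      conv_lhs => arg 3; rw [hχ]
      rw [inner_sub_right, inner_sub_right, inner_smul_right, inner_smul_right, hχ0, hχ2]
      simp
    rw [← this, inner_self_eq_norm_sq_to_K]
    norm_cast
  have hnorm : ‖χ‖ ^ 2 = 1 - ‖a‖ ^ 2 - ‖b‖ ^ 2 := by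
    have h : inner ℂ χ (ψ 1) = 1 - (starRingEnd ℂ) a * a - (starRingEnd ℂ) b * b := by
      rw [hχ, inner_sub_left, inner_sub_left, inner_smul_left, inner_smul_left, hself]
    rw [hχ1, Complex.conj_mul', Complex.conj_mul'] at h
    exact_mod_cast h
  have hχnn : 0 ≤ ‖χ‖ ^ 2 := by positivity
  have hann : 0 ≤ ‖a‖ ^ 2 := by positivity
  have hbnn : 0 ≤ ‖b‖ ^ 2 := by positivity
  obtain ⟨α, hα, hbα⟩ := exists_polar_angle b
  obtain ⟨ω, hω, haω⟩ := exists_polar_angle a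
  -- Since `r² = ‖a‖² + ‖χ‖²`, the pair `(‖χ‖, ‖a‖)` has polar coordinates `r, θ`. If `r = 0`,
  -- division by zero gives `θ = 0`, which is harmless.
  set r := √(1 - ‖b‖ ^ 2) with hr
  have hr0 : 0 ≤ r := Real.sqrt_nonneg _
  have hr2 : r ^ 2 = 1 - ‖b‖ ^ 2 := Real.sq_sqrt (by linarith)
  have har : ‖a‖ ≤ r := Real.le_sqrt_of_sq_le (by linarith)
  have hx0 : 0 ≤ ‖a‖ / r := by positivity
  have hx1 : ‖a‖ / r ≤ 1 := div_le_one_of_le₀ har hr0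
  set θ := Real.arcsin (‖a‖ / r) with hθ
  have hsin : r * Real.sin θ = ‖a‖ := by
    rw [hθ, Real.sin_arcsin (by linarith) hx1]
    by_cases h : r = 0
    · have : ‖a‖ = 0 := le_antisymm (h ▸ har) (norm_nonneg _)
      rw [this, h, zero_mul]
    · field_simp
  have hcos : r * Real.cos θ = ‖χ‖ := by
    have hc0 : 0 ≤ Real.cos θ := Real.cos_arcsin_nonneg _
    rw [← sq_eq_sq₀ (mul_nonneg hr0 hc0) (norm_nonneg _), hnorm, ← hsin, mul_pow, mul_pow,
      Real.cos_sq', hr2]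
    ring_nf
  have hsqrt : √(1 - r ^ 2) = ‖b‖ := by
    rw [hr2, sub_sub_cancel, Real.sqrt_sq (norm_nonneg _)]
  -- Coordinates along `ψ 0`, `ψ 2` and `χ / ‖χ‖`. If `χ = 0`, the inverse is `0` and so is the
  -- third coordinate. Only the Gram matrix of `ψ` has to be preserved.
  let L : H →ₗ[ℂ] EuclideanSpace ℂ (Fin 3) :=
    (WithLp.linearEquiv 2 ℂ (Fin 3 → ℂ)).symm.toLinearMap ∘ₗ LinearMap.pi
      ![(innerSL ℂ (ψ 0) : H →L[ℂ] ℂ).toLinearMap, (innerSL ℂ (ψ 2) : H →L[ℂ] ℂ).toLinearMap,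
        ((‖χ‖⁻¹ : ℝ) : ℂ) • (innerSL ℂ χ : H →L[ℂ] ℂ).toLinearMap]
  have hL : ∀ v, L v = !₂[inner ℂ (ψ 0) v, inner ℂ (ψ 2) v, ((‖χ‖⁻¹ : ℝ) : ℂ) * inner ℂ χ v] := by
    intro v
    ext i
    fin_cases i <;> rfl
  have hχχ : ((‖χ‖⁻¹ : ℝ) : ℂ) * inner ℂ χ (ψ 1) = ((‖χ‖ : ℝ) : ℂ) := by
    rw [hχ1, ← Complex.ofReal_mul]
    congr 1
    by_cases h : ‖χ‖ = 0
    · simp [h]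
    · field_simp
  have hLψ : ∀ j, L (ψ j) = (![!₂[1, 0, 0], !₂[a, b, ((‖χ‖ : ℝ) : ℂ)], !₂[0, 1, 0]] :
      Fin 3 → EuclideanSpace ℂ (Fin 3)) j := by
    intro j
    rw [hL]
    fin_cases j
    · simp [hψ, h20, hχ0]
    · simp only [Fin.mk_one, Matrix.cons_val_one, Matrix.cons_val_zero, hχχ, ← ha, ← hb]
    · simp [hψ, h02, hχ2]
  have hgen : ∀ j, L (ψ j) = genericState r θ α ω j := by
    intro j
    rw [hLψ, genericState, hsin, hsqrt, hcos, ← haω, ← hbα]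
  refine ⟨r, θ, α, ω, ⟨hr0, ?_⟩, ⟨Real.arcsin_nonneg.2 hx0, Real.arcsin_le_pi_div_two _⟩, hα, hω,
    hsin.trans_le hs, hsqrt.trans_le ht, isometryOfGram ψ L ?_, hgen⟩
  · exact Real.sqrt_le_one.2 (by linarith)
  · have h11 : a * (starRingEnd ℂ) a + b * (starRingEnd ℂ) b + ((‖χ‖ : ℝ) : ℂ) * ‖χ‖ = 1 := by
      rw [Complex.mul_conj', Complex.mul_conj']
      have : ‖a‖ ^ 2 + ‖b‖ ^ 2 + ‖χ‖ * ‖χ‖ = 1 := by linarith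
      exact_mod_cast this
    intro j k
    rw [hLψ, hLψ]
    fin_cases j <;> fin_cases k <;>
      simp [PiLp.inner_apply, Fin.sum_univ_three, hself, h02, h20, ha', hb', ← ha, ← hb,
        -inner_self_eq_norm_sq_to_K]
    exact h11

end NormalForm

end HeraldingCoin

end

theorem mainTheorem5
    (p q : ℝ) (hp : p ∈ Set.Icc (0 : ℝ) 1) (hq : q ∈ Set.Icc (0 : ℝ) 1) (hpq : 0 < p + q)
    (coin : Measure (ℤ → Fin 2)) [IsProbabilityMeasure coin] (hcoin : IsPerturbedCoin p q coin) :
    -- the probabilities of the three classes of pasts, and the memory state of `Q⁻`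
    (∀ j : Fin 3, (reversedHeraldingLaw coin).real {y | past y 0 = j} = retroWeight p q j) ∧
    memoryState (reversedHeraldingLaw coin) (retroEncode q) =
      mixture (retroWeight p q) (retroState q) ∧
    -- `Q⁻` is an optimal quantum model of the time-reversed heralding coin
    IsOptimalQuantumModel.{u, v} (reversedHeraldingLaw coin) (retroEncode q) (retroKraus p q) ∧
    -- models with one internal state per causal state: fidelity constraints and generic form
    (0 < p → p < 1 → 0 < q →
      ∀ (H : Type u) [NormedAddCommGroup H] [InnerProductSpace ℂ H] [CompleteSpace H]
        (κ : Type v) (ψ : Fin 3 → H) (K : Fin 3 → κ → H →L[ℂ] H),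
        IsQuantumModel (reversedHeraldingLaw coin) (fun y => ψ (y 0)) K →
        (∀ j k, ‖inner ℂ (ψ j) (ψ k)‖ ≤ ‖inner ℂ (retroState q j) (retroState q k)‖) ∧
        ∃ r θ α ω : ℝ, r ∈ Set.Icc (0 : ℝ) 1 ∧ θ ∈ Set.Icc (0 : ℝ) (Real.pi / 2) ∧
          α ∈ Set.Icc (0 : ℝ) (2 * Real.pi) ∧ ω ∈ Set.Icc (0 : ℝ) (2 * Real.pi) ∧
          r * Real.sin θ ≤ √q ∧ √(1 - r ^ 2) ≤ √(1 - q) ∧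
          ∃ U : Submodule.span ℂ (Set.range ψ) →ₗᵢ[ℂ] EuclideanSpace ℂ (Fin 3),
            ∀ j, U ⟨ψ j, Submodule.subset_span ⟨j, rfl⟩⟩ = genericState r θ α ω j) ∧
    -- states obeying the fidelity constraints: majorization of the spectra
    (∀ (H : Type u) [NormedAddCommGroup H] [InnerProductSpace ℂ H] [CompleteSpace H]
      (ψ : Fin 3 → H), (∀ j, ‖ψ j‖ = 1) →
      (∀ j k, ‖inner ℂ (ψ j) (ψ k)‖ ≤ ‖inner ℂ (retroState q j) (retroState q k)‖) →
      Majorizes (spec (mixture (retroWeight p q) (retroState q)))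
        (spec (mixture (retroWeight p q) ψ))) := by
  have hlaw := memoryState_retroEncode hp hq hcoin
  refine ⟨reversedHeraldingLaw_real hcoin hp hq, hlaw, isOptimalQuantumModel_retro hp hq hcoin,
    fun hp0 hp1 hq0 H _ _ _ κ ψ K h => ?_, fun H _ _ _ ψ hψ hov => ?_⟩
  · have hov := norm_inner_le_of_isQuantumModel hp0 hp1 hq0 hq.2 hcoin h
    refine ⟨hov, ?_⟩
    have hψ : ∀ j, ‖ψ j‖ = 1 := fun j => h.norm_encode fun _ => j
    have h02 : inner ℂ (ψ 0) (ψ 2) = 0 := by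
      have := hov 0 2
      simpa [retroState, PiLp.inner_apply, Fin.sum_univ_two] using this
    refine exists_isometry_genericState hψ h02 ((hov 0 1).trans_eq ?_) ((hov 2 1).trans_eq ?_)
    · simp [retroState, PiLp.inner_apply, Fin.sum_univ_two, abs_of_nonneg, Real.sqrt_nonneg]
    · simp [retroState, PiLp.inner_apply, Fin.sum_univ_two, abs_of_nonneg, Real.sqrt_nonneg]
  -- The three states are averaged over the last symbol of the past; the comparison uses their
  -- overlaps only, no dynamics.
  · have hF : AEStronglyMeasurable (fun y : ℤ → Fin 3 => ψ (past y 0))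
        (reversedHeraldingLaw coin) :=
      (StronglyMeasurable.of_discrete.comp_measurable measurable_past_zero).aestronglyMeasurable
    have hm := (retro_majorizes_and_entropy_le hq hF (fun y => hψ _) measurable_past_zero
      (retroWeight_eq hp hq hcoin) (Filter.Eventually.of_forall fun x =>
        Filter.Eventually.of_forall fun x' => hov _ _)).1
    rwa [integral_ketBra_comp (cls := fun y : ℤ → Fin 3 => past y 0) measurable_past_zero ψ,
      ← retroWeight_eq hp hq hcoin] at hm
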